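/- **Setting.** Let $K$ be a local field of characteristic $p>0$ with absolute value $|\cdot|$, $\mathcal O=\{|x|\le 1\}$, $\mathfrak P=\{|x|<1\}$, $\mathfrak p$ a prime element ($\mathfrak P=\mathfrak p\mathcal O$), $q=p^c=|\mathcal O/\mathfrak P|$, and $dx$ the Haar measure of $K^+$ with $|\mathcal O|=1$. Fix $1=\epsilon_0,\dots,\epsilon_{c-1}\in\mathcal O$ with $|\epsilon_i|=1$ whose residue classes form a basis of $\mathcal O/\mathfrak P$ over $GF(p)$. For $0\le b<q$, $b=\sum_{i<c}a_ip^i$ with $0\le a_i<p$, put $u(b)=\big(\sum_{i<c} a_i\epsilon_i\big)\mathfrak p^{-1}$; for $n=\sum_k b_kq^k$ with $0\le b_k<q$ put $u(n)=\sum_k u(b_k)\mathfrak p^{-k}$. Let $\mathcal Z=\{u(n):n\in\mathbb N_0\}$. Let $\chi$ be a character of $K^+$ that is trivial on $\mathcal O$, nontrivial on $\mathfrak P^{-1}=\mathfrak p^{-1}\mathcal O$, and normalized so that $\chi(\epsilon_i\epsilon_j\mathfrak p^{-m})=1$ for all $i,j$ and all $m\ge 2$. Let $\hat f$ be the extension to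 $L^2(K)$ of $\hat f(\xi)=\int_K f(x)\chi(-\xi x)\,dx$, and let $T_kf(x)=f(x-u(k))$, $D_{\mathfrak p}f(x)=q^{1/2}f(\mathfrak p^{-1}x)$. For $A\subset K$, a closed subspace $V\subset L^2(K)$ is $A$-TI if $f\in V$ implies $f(\cdot-a)\in V$ for all $a\in A$; and $V_\varphi=\overline{\mathrm{span}}\{T_k\varphi:k\in\mathbb N_0\}$. A Parseval frame for $V$ is a family $(g_i)$ in $V$ with $\sum_i|\langle f,g_i\rangle|^2=\|f\|^2$ for all $f\in V$. For a $\mathcal Z$-TI space $V$ let $J(\xi)\subset\ell^2(\mathbb N_0)$ be its range function: the closed span of the fibers $\big(\hat f(\xi+u(k))\big)_{k\in\mathbb N_0}$, with $f$ running through a countable dense subset of $V$ (up to null sets it does not depend on that subset). Let $m_V(\xi)=\dim J(\xi)\in\{0,1,\dots,\infty\}$, and define the spectral function by $\sigma_V(\xi+u(k))=\|P_{J(\xi)}e_k\|^2$ for $\xi\in\mathcal O$, $k\in\mathbb N_0$, where $P_{J(\xi)}$ is the orthogonal projection onto $J(\xi)$ and $(e_k)$ is the standard basis. **Theorem.** (A)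 Let $V$ be a $\mathcal Z$-TI space with a finite or infinite sequence of generators $(\varphi_n)_{n=1}^N$ such that $\{T_k\varphi_n: k\in\mathbb N_0,\,1\le n\le N\}$ is a Parseval frame for $V$. Then $\sigma_V(\xi)=\sum_{n=1}^N|\hat\varphi_n(\xi)|^2$ for a.e. $\xi\in K$; in particular this sum does not depend, up to null sets, on the choice of such generators. (B) Let $\nu$ be the set of all $\mathcal Z$-TI spaces. All spaces $V_\varphi$ belong to $\nu$. There is exactly one mapping $\sigma:\nu\to L^\infty(K)$, $V\mapsto\sigma_V$, such that for every $\varphi\in L^2(K)$ $$\sigma_{V_\varphi}(\xi)=\begin{cases}|\hat\varphi(\xi)|^2\Big(\sum_{k\in\mathbb N_0}|\hat\varphi(\xi+u(k))|^2\Big)^{-1}&\text{if }\hat\varphi(\xi)\ne 0,\\ 0&\text{otherwise}\end{cases}\qquad\text{for a.e. }\xi,$$ and such that $V=\bigoplus_{n=1}^\infty V_{\varphi_n}$ (orthogonal sum) implies $\sigma_V=\sum_{n=1}^\infty\sigma_{V_{\varphi_n}}$ a.e.; this mapping is the spectral function. Moreover, the spectral function is additive on all countable orthogonal sums: if $V=\bigoplus_n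 V_n$ with $V,V_n\in\nu$, then $\sigma_V=\sum_n\sigma_{V_n}$ a.e. (C) If $V$ is a $\mathcal Z$-TI space with an orthogonal decomposition $V=\bigoplus_{n=1}^N V_{\varphi_n}$, $N$ finite or infinite, where $\{T_k\varphi_n:k\in\mathbb N_0\}$ is a Parseval frame for $V_{\varphi_n}$ for each $n$, then $\sigma_V(\xi)=\sum_{n=1}^N|\hat\varphi_n(\xi)|^2$ for a.e. $\xi$. (D) If $V$ is a $\mathcal Z$-TI space, then $D_{\mathfrak p}(V)$ is $\mathfrak p\mathcal Z$-TI (and hence $\mathcal Z$-TI), and $\sigma_{D_{\mathfrak p}(V)}(\xi)=\sigma_V(\mathfrak p\xi)$ for a.e. $\xi$. (E) If $V$ is a $\mathcal Z$-TI space, then $m_V(\xi)=\sum_{k\in\mathbb N_0}\sigma_V(\xi+u(k))$ for a.e. $\xi$. -/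

import Mathlib

open MeasureTheory
open scoped ENNReal

/-- The standing choices for harmonic analysis on a local field `K` of characteristic `p`
(`K` is a complete locally compact field whose topology is given by a nontrivial ultrametric
absolute value): a prime element, a system of representatives for a basis of the residue field
over the prime field, and a basic character. Here `𝒪 = {‖x‖ ≤ 1}` and `𝔓 = {‖x‖ < 1}`. -/
structure LocalFieldSetting (K : Type*) [NontriviallyNormedField K] (p : ℕ) where
  /-- the prime element `𝔭` -/
  prime : K
  prime_lt_one : ‖prime‖ < 1
  prime_max : ∀ x : K, ‖x‖ < 1 → ‖x‖ ≤ ‖prime‖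
  /-- the degree `c` of the residue field over its prime field -/
  deg : ℕ
  deg_pos : 0 < deg
  /-- the units `1 = ε₀, ε₁, …, ε_{c-1}` -/
  eps : Fin deg → K
  eps_zero : eps ⟨0, deg_pos⟩ = 1
  norm_eps : ∀ i, ‖eps i‖ = 1
  /-- the residue classes of the `ε i` are a basis of `𝒪 / 𝔓` over the field with `p` elements -/
  eps_basis : ∀ x : K, ‖x‖ ≤ 1 →
    ∃! a : Fin deg → Fin p, ‖x - ∑ i, ((a i : ℕ) : K) * eps i‖ < 1
  /-- the basic character of the additive group of `K` -/
  chi : AddChar K Circle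
  /-- `χ` is trivial on `𝒪` -/
  chi_trivial : ∀ x : K, ‖x‖ ≤ 1 → chi x = 1
  /-- `χ` is not trivial on `𝔓⁻¹ = 𝔭⁻¹ 𝒪` -/
  chi_nontrivial : ∃ x : K, ‖prime * x‖ ≤ 1 ∧ chi x ≠ 1
  /-- `χ` is normalized with respect to `𝔭` and the `ε i`. (If the `ε i` span a subfield, this says
  that `χ (ε i * 𝔭⁻ᵐ) = 1` for `m ≥ 2`; it makes `χ` trivial on all products `u(k) u(l)`, and does
  not follow from the other properties.) -/
  chi_normalized : ∀ (i j : Fin deg) (m : ℕ), 2 ≤ m →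
    chi (eps i * eps j * prime⁻¹ ^ m) = 1

namespace LocalFieldSetting

section Lattice

variable {K : Type*} [NontriviallyNormedField K] {p : ℕ} (S : LocalFieldSetting K p)

lemma prime_ne_zero : S.prime ≠ 0 := by
  intro h
  obtain ⟨x, hx0, hx1⟩ := NormedField.exists_norm_lt_one K
  have h2 := S.prime_max x hx1
  rw [h, norm_zero] at h2
  exact absurd hx0 (not_lt.mpr h2)

/-- The cardinality `q = p ^ c` of the residue field. -/
def q : ℕ := p ^ S.deg

/-- `u(b) = (a₀ ε₀ + ⋯ + a_{c-1} ε_{c-1}) 𝔭⁻¹` for `b = a₀ + a₁ p + ⋯ + a_{c-1} p ^ (c-1) < q`. -/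
noncomputable def uDigit (b : ℕ) : K :=
  (∑ i : Fin S.deg, ((b / p ^ (i : ℕ) % p : ℕ) : K) * S.eps i) * S.prime⁻¹

/-- `u(n) = ∑ u(b_k) 𝔭 ^ (-k)`, where `n = ∑ b_k q ^ k` is the expansion of `n` in base `q`
(the digits `b_k` with `n ≤ k` are zero). -/
noncomputable def u (n : ℕ) : K :=
  ∑ k ∈ Finset.range n, S.uDigit (n / S.q ^ k % S.q) * S.prime⁻¹ ^ k

/-- The translation set `𝒵 = {u(n) : n ∈ ℕ}`. -/
def lattice : Set K := Set.range S.u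

/-- The dilated translation set `𝔭𝒵`. -/
def dilatedLattice : Set K := Set.range fun n => S.prime * S.u n

end Lattice

section Spaces

variable {K : Type*} [NontriviallyNormedField K] [MeasurableSpace K] [BorelSpace K]
  [ProperSpace K] {p : ℕ} (S : LocalFieldSetting K p)
  (μ : Measure K) [μ.IsAddHaarMeasure]

/-- Translation on `L²(K)`: `(translate μ a f)(x) = f (x - a)`. -/
noncomputable def translate (a : K) : Lp ℂ 2 μ →ₗᵢ[ℂ] Lp ℂ 2 μ :=
  Lp.compMeasurePreservingₗᵢ ℂ (fun x => x - a) (measurePreserving_sub_right μ a)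

/-- The translation `T_k` by `u(k)`. -/
noncomputable def T (k : ℕ) : Lp ℂ 2 μ →ₗᵢ[ℂ] Lp ℂ 2 μ := translate μ (S.u k)

lemma map_mul_left {a : K} (ha : a ≠ 0) :
    ∃ c : ℝ≥0∞, c ≠ ∞ ∧ Measure.map (fun x => a * x) μ = c • μ := by
  have h : (Measure.map (AddMonoidHom.mulLeft a) μ).IsAddHaarMeasure :=
    Measure.isAddHaarMeasure_map μ (AddMonoidHom.mulLeft a)
      (continuous_const_mul a) (mul_left_surjective₀ ha)
      (by
        have := (Homeomorph.mulLeft₀ a ha).isClosedEmbedding.tendsto_cocompact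
        exact this)
  exact ⟨_, ENNReal.coe_ne_top,
    Measure.isAddLeftInvariant_eq_smul (Measure.map (AddMonoidHom.mulLeft a) μ) μ⟩

lemma memLp_comp_mul {a : K} (ha : a ≠ 0) {f : K → ℂ} (hf : MemLp f 2 μ) :
    MemLp (fun x => f (a * x)) 2 μ := by
  obtain ⟨c, hc, h⟩ := map_mul_left μ ha
  have h1 : MemLp f 2 (Measure.map (fun x => a * x) μ) := by
    rw [h]
    exact hf.smul_measure hc
  exact h1.comp_of_map (continuous_const_mul a).measurable.aemeasurable

lemma ae_comp_mul {a : K} (ha : a ≠ 0) {P : K → Prop} (hP : ∀ᵐ x ∂μ, P x) :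
    ∀ᵐ x ∂μ, P (a * x) := by
  obtain ⟨c, hc, h⟩ := map_mul_left μ ha
  have h1 : ∀ᵐ x ∂(Measure.map (fun x => a * x) μ), P x := by
    rw [h]
    exact Measure.ae_smul_measure hP c
  exact ae_of_ae_map (continuous_const_mul a).measurable.aemeasurable h1

/-- The dilation `D_𝔭` on `L²(K)`: `(D_𝔭 f)(x) = q ^ (1/2) f (𝔭⁻¹ x)`. -/
noncomputable def dilate : Lp ℂ 2 μ →ₗ[ℂ] Lp ℂ 2 μ where
  toFun f := (Real.sqrt S.q : ℂ) •
    (memLp_comp_mul μ (inv_ne_zero S.prime_ne_zero) (Lp.memLp f)).toLp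
      (fun x => f (S.prime⁻¹ * x))
  map_add' f g := by
    rw [← smul_add, ← MemLp.toLp_add]
    congr 1
    exact MemLp.toLp_congr _ _
      (ae_comp_mul μ (P := fun x => (f + g : Lp ℂ 2 μ) x = ((f : K → ℂ) + g) x)
        (inv_ne_zero S.prime_ne_zero) (Lp.coeFn_add f g))
  map_smul' r f := by
    have h : (memLp_comp_mul μ (inv_ne_zero S.prime_ne_zero) (Lp.memLp (r • f))).toLp
        (fun x => (r • f : Lp ℂ 2 μ) (S.prime⁻¹ * x)) =
        r • (memLp_comp_mul μ (inv_ne_zero S.prime_ne_zero) (Lp.memLp f)).toLp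
          (fun x => f (S.prime⁻¹ * x)) := by
      rw [← MemLp.toLp_const_smul]
      exact MemLp.toLp_congr _ _
        (ae_comp_mul μ (P := fun x => (r • f : Lp ℂ 2 μ) x = (r • (f : K → ℂ)) x)
          (inv_ne_zero S.prime_ne_zero) (Lp.coeFn_smul r f))
    rw [RingHom.id_apply, smul_comm r, h]

open Classical in
/-- The Fourier transform on `L²(K)`: the continuous linear extension to `L²(K)` of
`f ↦ (ξ ↦ ∫ f(x) χ(-ξx) dx)`, initially given on `L¹(K) ∩ L²(K)`. (Since `L¹ ∩ L²` is dense, there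
is only one extension; it exists by Plancherel's theorem.) -/
noncomputable def fourier : Lp ℂ 2 μ →L[ℂ] Lp ℂ 2 μ :=
  if h : ∃ F : Lp ℂ 2 μ →L[ℂ] Lp ℂ 2 μ, ∀ f : Lp ℂ 2 μ, Integrable f μ →
      F f =ᵐ[μ] Fourier.fourierIntegral S.chi μ f
  then h.choose else 0

/-- A closed subspace of `L²(K)` is translation invariant under `A` if it contains with `f` all
translates of `f` by elements of `A`. -/
def IsTI (A : Set K) (V : Submodule ℂ (Lp ℂ 2 μ)) : Prop :=
  IsClosed (V : Set (Lp ℂ 2 μ)) ∧ ∀ a ∈ A, ∀ f ∈ V, translate μ a f ∈ V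

/-- The set `ν` of all `𝒵`-translation invariant spaces. -/
abbrev TISpace : Type _ := {V : Submodule ℂ (Lp ℂ 2 μ) // IsTI μ S.lattice V}

/-- The principal space `V_φ`: the closed span of `{T_k φ : k ∈ ℕ}`. -/
noncomputable def principal (φ : Lp ℂ 2 μ) : Submodule ℂ (Lp ℂ 2 μ) :=
  (Submodule.span ℂ (Set.range fun k => S.T μ k φ)).topologicalClosure

variable {μ}

/-- The family `g` is a Parseval frame for the space `V`. -/
def IsParsevalFrame {ι : Type*} (V : Submodule ℂ (Lp ℂ 2 μ)) (g : ι → Lp ℂ 2 μ) : Prop :=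
  (∀ i, g i ∈ V) ∧ ∀ f ∈ V, HasSum (fun i => ‖inner ℂ (g i) f‖ ^ 2) (‖f‖ ^ 2)

/-- `V` is the orthogonal (Hilbert) sum of the spaces `W i`. -/
def IsOrthogonalSum {ι : Type*} (V : Submodule ℂ (Lp ℂ 2 μ))
    (W : ι → Submodule ℂ (Lp ℂ 2 μ)) : Prop :=
  (Pairwise fun i j => W i ⟂ W j) ∧ V = (⨆ i, W i).topologicalClosure

open Classical in
/-- The fiberization `𝒯 f (ξ) = (f̂(ξ + u(k)))_k` in `ℓ²`, which makes sense for a.e. `ξ`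
(elsewhere it is set to `0`). -/
noncomputable def fiber (f : Lp ℂ 2 μ) (ξ : K) : lp (fun _ : ℕ => ℂ) 2 :=
  if h : Memℓp (fun k : ℕ => S.fourier μ f (ξ + S.u k)) 2 then ⟨_, h⟩ else 0

instance separableSpace_subspace (V : Submodule ℂ (Lp ℂ 2 μ)) :
    TopologicalSpace.SeparableSpace V := by
  have : Fact ((2 : ℝ≥0∞) ≠ ∞) := ⟨by norm_num⟩
  have : SecondCountableTopology (Lp ℂ 2 μ) := inferInstance
  infer_instance

/-- The range function `J(ξ) = {𝒯 f (ξ) : f ∈ V}` of `V`. As the elements `f` of `V` are defined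
only up to null sets, the set of fibers is taken along a countable dense subset of `V` and closed
up; another dense subset changes `J` only on a null set. -/
noncomputable def rangeFunction (V : Submodule ℂ (Lp ℂ 2 μ)) (ξ : K) :
    Submodule ℂ (lp (fun _ : ℕ => ℂ) 2) :=
  (Submodule.span ℂ
    (Set.range fun n => S.fiber (TopologicalSpace.denseSeq V n : Lp ℂ 2 μ) ξ)).topologicalClosure

instance completeSpace_rangeFunction (V : Submodule ℂ (Lp ℂ 2 μ)) (ξ : K) : CompleteSpace (S.rangeFunction V ξ) :=
  Submodule.topologicalClosure.completeSpace _

/-- The multiplicity function `m_V(ξ) = dim J(ξ)`, with values in `{0, 1, 2, …, ∞}`. -/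
noncomputable def multiplicity (V : Submodule ℂ (Lp ℂ 2 μ)) (ξ : K) : ℕ∞ :=
  Cardinal.toENat (Module.rank ℂ (S.rangeFunction V ξ))

open Classical in
/-- The spectral function: `σ_V(ξ + u(k)) = ‖P_{J(ξ)} e_k‖²` for `ξ ∈ 𝒪` and `k ∈ ℕ`. Each `x : K`
is `ξ + u(k)` for exactly one such pair, and `Nat.find` picks its `k`. -/
noncomputable def spectral (V : Submodule ℂ (Lp ℂ 2 μ)) (x : K) : ℝ :=
  if h : ∃ k : ℕ, ‖x - S.u k‖ ≤ 1 then
    ‖(S.rangeFunction V (x - S.u (Nat.find h))).starProjection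
      (lp.single 2 (Nat.find h) (1 : ℂ))‖ ^ 2
  else 0

open Classical in
/-- The function equal to `|φ̂(ξ)|² (∑ₖ |φ̂(ξ + u(k))|²)⁻¹` on the support of `φ̂`, and to `0`
elsewhere. (The sum is finite for a.e. `ξ`.) -/
noncomputable def principalSpectral (φ : Lp ℂ 2 μ) (ξ : K) : ℝ :=
  if S.fourier μ φ ξ ≠ 0 then
    ‖S.fourier μ φ ξ‖ ^ 2 * (∑' k : ℕ, ‖S.fourier μ φ (ξ + S.u k)‖ ^ 2)⁻¹
  else 0

variable (μ)

/-- A mapping from `𝒵`-translation invariant spaces to `L^∞(K)` with the prescribed values on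
principal spaces, and additive on orthogonal sums of sequences of principal spaces. -/
structure IsSpectralMap (s : S.TISpace μ → Lp ℂ ∞ μ) : Prop where
  principal_eq : ∀ (φ : Lp ℂ 2 μ) (W : S.TISpace μ), W.1 = S.principal μ φ →
    ∀ᵐ ξ ∂μ, s W ξ = (S.principalSpectral φ ξ : ℂ)
  additive : ∀ (V : S.TISpace μ) (φ : ℕ → Lp ℂ 2 μ) (W : ℕ → S.TISpace μ),
    (∀ n, (W n).1 = S.principal μ (φ n)) → IsOrthogonalSum V.1 (fun n => (W n).1) →
    ∀ᵐ ξ ∂μ, HasSum (fun n => s (W n) ξ) (s V ξ)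

end Spaces

end LocalFieldSetting

set_option linter.unusedSectionVars false

/-! The set 𝒵 is a subgroup of K⁺ (in characteristic p digits add without carry), 𝒪 is a fundamental
domain for it, and χ is trivial on 𝒪 and on all products u(k)u(l). Hence the functions χ(u(k)·) cut
off to the cells u(l) + 𝒪 form an orthonormal basis of L²(K): orthogonality is `integral_char_cell`,
completeness is Stone–Weierstrass on a cell. The Fourier integral permutes this basis
(`fourierIntegral_gaborFun`), which gives Plancherel's theorem (`fourier_eq`).

On the Fourier side T_k is multiplication by χ(-u(k)·), a 𝒵-periodic function, so it multiplies each
fiber by a scalar (`fiber_T`). Consequently the projection onto a 𝒵-TI space V acts fiber by fiber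
as the projection onto J(ξ) (`fiber_starProjection`). Let g_E be the function with transform 1_E, E
inside one cell. Then ∫_E σ_V = ‖P_V g_E‖² (`setLIntegral_spectral`), and these integrals determine
σ_V almost everywhere.

The assertions now become Hilbert space identities for ‖P_V g_E‖². Expanding it in a Parseval frame
gives (A); Pythagoras gives additivity in (B), and with (A) for single generators also (C); the
dilation commutes with projections, which gives (D). The formula for V_φ holds because its range
function is spanned by the single fiber of φ. Uniqueness in (B) follows since Gram–Schmidt splits
every V into principal spaces. Finally (E) says that the trace of a projection is its rank. -/

namespace LocalFieldSetting

/-! ### The lattice 𝒵: subgroup, fundamental domain, self-duality under χ -/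

section LatticeLemmas

variable {K : Type*} [NontriviallyNormedField K] {p : ℕ} (S : LocalFieldSetting K p)

lemma norm_sub_le_of_le_of_le [IsUltrametricDist K] {x y : K} {r : ℝ} (hx : ‖x‖ ≤ r)
    (hy : ‖y‖ ≤ r) : ‖x - y‖ ≤ r := by
  rw [sub_eq_add_neg]
  exact (IsUltrametricDist.norm_add_le_max x (-y)).trans (max_le hx (by rwa [norm_neg]))

/-- The combination `∑ aᵢ εᵢ` whose coefficients are the base `p` digits of `b`. -/
noncomputable def epsSum (b : ℕ) : K :=
  ∑ i : Fin S.deg, ((b / p ^ (i : ℕ) % p : ℕ) : K) * S.eps i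

lemma uDigit_eq (b : ℕ) : S.uDigit b = S.epsSum b * S.prime⁻¹ := rfl

@[simp] lemma epsSum_zero : S.epsSum 0 = 0 := by simp [epsSum]

@[simp] lemma uDigit_zero : S.uDigit 0 = 0 := by simp [uDigit_eq]

@[simp] lemma u_zero : S.u 0 = 0 := by simp [u]

lemma one_lt_q [hp : Fact p.Prime] : 1 < S.q := Nat.one_lt_pow S.deg_pos.ne' hp.out.one_lt

lemma q_pos [Fact p.Prime] : 0 < S.q := S.one_lt_q.le

/-- Since n < q ^ n, the digits from position n on vanish, so the cutoff in the definition of `u`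
may be enlarged at will. -/
lemma u_eq_sum_range [Fact p.Prime] {n N : ℕ} (h : n ≤ N) :
    S.u n = ∑ k ∈ Finset.range N, S.uDigit (n / S.q ^ k % S.q) * S.prime⁻¹ ^ k := by
  refine Finset.sum_subset (by simpa using h) fun k _ hk => ?_
  have hlt : n < S.q ^ k :=
    (not_lt.mp (by simpa using hk)).trans_lt (Nat.lt_pow_self S.one_lt_q)
  simp [Nat.div_eq_of_lt hlt]

lemma u_add_mul [Fact p.Prime] {b : ℕ} (hb : b < S.q) (n : ℕ) :
    S.u (b + S.q * n) = S.uDigit b + S.prime⁻¹ * S.u n := by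
  have hn : n ≤ b + S.q * n := (Nat.le_mul_of_pos_left n S.q_pos).trans (Nat.le_add_left _ _)
  rw [S.u_eq_sum_range (Nat.le_succ (b + S.q * n)), Finset.sum_range_succ', S.u_eq_sum_range hn,
    Finset.mul_sum, add_comm]
  congr 1
  · simp [Nat.mod_eq_of_lt hb]
  · refine Finset.sum_congr rfl fun k _ => ?_
    rw [pow_succ' S.q, ← Nat.div_div_eq_div_mul, Nat.add_mul_div_left _ _ S.q_pos,
      Nat.div_eq_of_lt hb, zero_add, pow_succ]
    ring

lemma u_q_mul [Fact p.Prime] (n : ℕ) : S.u (S.q * n) = S.prime⁻¹ * S.u n := by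
  simpa using S.u_add_mul S.q_pos n

lemma u_mod_add_div [Fact p.Prime] (n : ℕ) :
    S.u n = S.uDigit (n % S.q) + S.prime⁻¹ * S.u (n / S.q) := by
  conv_lhs => rw [← Nat.mod_add_div n S.q]
  exact S.u_add_mul (Nat.mod_lt _ S.q_pos) _

lemma epsSum_finFunctionFinEquiv (a : Fin S.deg → Fin p) :
    S.epsSum (finFunctionFinEquiv a : ℕ) = ∑ i, ((a i : ℕ) : K) * S.eps i := by
  refine Finset.sum_congr rfl fun i _ => ?_
  rw [← finFunctionFinEquiv_symm_apply_val, Equiv.symm_apply_apply]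

lemma exists_epsSum [Fact p.Prime] {x : K} (hx : ‖x‖ ≤ 1) :
    ∃ b < S.q, ‖x - S.epsSum b‖ < 1 := by
  obtain ⟨a, ha, -⟩ := S.eps_basis x hx
  exact ⟨_, (finFunctionFinEquiv a).2, by simpa only [S.epsSum_finFunctionFinEquiv] using ha⟩

lemma norm_epsSum_le [IsUltrametricDist K] (b : ℕ) : ‖S.epsSum b‖ ≤ 1 := by
  refine IsUltrametricDist.norm_sum_le_of_forall_le_of_nonneg zero_le_one fun i _ => ?_
  rw [norm_mul, S.norm_eps, mul_one]
  exact IsUltrametricDist.norm_natCast_le_one K _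

lemma epsSum_inj [IsUltrametricDist K] [Fact p.Prime] {b b' : ℕ} (hb : b < S.q) (hb' : b' < S.q)
    (h : ‖S.epsSum b - S.epsSum b'‖ < 1) : b = b' := by
  obtain ⟨a, rfl⟩ : ∃ a : Fin S.deg → Fin p, (finFunctionFinEquiv a : ℕ) = b :=
    ⟨finFunctionFinEquiv.symm ⟨b, hb⟩, by simp⟩
  obtain ⟨a', rfl⟩ : ∃ a : Fin S.deg → Fin p, (finFunctionFinEquiv a : ℕ) = b' :=
    ⟨finFunctionFinEquiv.symm ⟨b', hb'⟩, by simp⟩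
  have huniq := (S.eps_basis _ (S.norm_epsSum_le (finFunctionFinEquiv a : ℕ))).unique
    (y₁ := a) (y₂ := a') (by simp only [S.epsSum_finFunctionFinEquiv, sub_self, norm_zero, zero_lt_one])
    (by simpa only [S.epsSum_finFunctionFinEquiv] using h)
  rw [huniq]

/-- In characteristic p the coefficients only matter modulo p, so base p digits are added
separately, without carry. -/
lemma exists_epsSum_add [Fact p.Prime] [CharP K p] (b b' : ℕ) :
    ∃ c < S.q, S.epsSum b + S.epsSum b' = S.epsSum c := by
  have hp : 0 < p := (Fact.out : p.Prime).pos
  refine ⟨_, (finFunctionFinEquiv fun i : Fin S.deg =>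
    (⟨(b / p ^ (i : ℕ) % p + b' / p ^ (i : ℕ) % p) % p, Nat.mod_lt _ hp⟩ : Fin p)).2, ?_⟩
  rw [S.epsSum_finFunctionFinEquiv, epsSum, epsSum, ← Finset.sum_add_distrib]
  refine Finset.sum_congr rfl fun i _ => ?_
  rw [← add_mul, ← Nat.cast_add]
  congr 1
  exact ((CharP.natCast_eq_natCast K p).mpr (Nat.mod_modEq _ _)).symm

lemma exists_u_add [Fact p.Prime] [CharP K p] (k l : ℕ) : ∃ m, S.u k + S.u l = S.u m := by
  induction k using Nat.strong_induction_on generalizing l with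
  | _ k ih =>
    rcases Nat.eq_zero_or_pos k with rfl | hk
    · exact ⟨l, by simp⟩
    · obtain ⟨m, hm⟩ := ih (k / S.q) (Nat.div_lt_self hk S.one_lt_q) (l / S.q)
      obtain ⟨c, hc, hc'⟩ := S.exists_epsSum_add (k % S.q) (l % S.q)
      refine ⟨c + S.q * m, ?_⟩
      rw [S.u_add_mul hc, S.u_mod_add_div k, S.u_mod_add_div l, ← hm, uDigit_eq, uDigit_eq,
        uDigit_eq, ← hc']
      ring

lemma exists_u_nsmul [Fact p.Prime] [CharP K p] (n k : ℕ) : ∃ m, (n : K) * S.u k = S.u m := by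
  induction n with
  | zero => exact ⟨0, by simp⟩
  | succ n ih =>
    obtain ⟨m, hm⟩ := ih
    obtain ⟨m', hm'⟩ := S.exists_u_add m k
    exact ⟨m', by rw [← hm', ← hm]; push_cast; ring⟩

/-- In characteristic p, -x = (p - 1)x, so closure under addition suffices. -/
lemma exists_u_neg [Fact p.Prime] [CharP K p] (k : ℕ) : ∃ m, -S.u k = S.u m := by
  obtain ⟨m, hm⟩ := S.exists_u_nsmul (p - 1) k
  refine ⟨m, ?_⟩
  rw [← hm, Nat.cast_sub (Fact.out : p.Prime).one_le, CharP.cast_eq_zero]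
  simp

/-- Multiplication by 𝔭 brings the lowest digits into 𝒪 and shifts the others down. The shifted
parts then differ by an element of 𝒪, so they agree by induction; what remains of the difference
lies in 𝔓, so the lowest digits agree as residues. -/
lemma eq_of_norm_u_sub_u_le [IsUltrametricDist K] [Fact p.Prime] (k l : ℕ)
    (h : ‖S.u k - S.u l‖ ≤ 1) : k = l := by
  induction hn : k + l using Nat.strong_induction_on generalizing k l with
  | _ n ih =>
    rcases Nat.eq_zero_or_pos n with h0 | hpos
    · omega
    · have hmul : S.prime * (S.u k - S.u l) =
          (S.epsSum (k % S.q) - S.epsSum (l % S.q)) + (S.u (k / S.q) - S.u (l / S.q)) := by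
        have := S.prime_ne_zero
        rw [S.u_mod_add_div k, S.u_mod_add_div l, uDigit_eq, uDigit_eq]
        field_simp
        ring
      have hlt : ‖S.prime * (S.u k - S.u l)‖ < 1 := by
        rw [norm_mul]
        exact (mul_le_of_le_one_right (norm_nonneg _) h).trans_lt S.prime_lt_one
      have heps : ‖S.epsSum (k % S.q) - S.epsSum (l % S.q)‖ ≤ 1 :=
        norm_sub_le_of_le_of_le (S.norm_epsSum_le _) (S.norm_epsSum_le _)
      have hdiv : k / S.q = l / S.q := by
        refine ih (k / S.q + l / S.q) ?_ _ _ ?_ rfl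
        · have h1 := Nat.div_le_self k S.q
          have h2 := Nat.div_le_self l S.q
          rcases Nat.eq_zero_or_pos k with hk | hk
          · have := Nat.div_lt_self (show 0 < l by omega) S.one_lt_q
            omega
          · have := Nat.div_lt_self hk S.one_lt_q
            omega
        · rw [← sub_eq_iff_eq_add'.mpr hmul]
          exact norm_sub_le_of_le_of_le hlt.le heps
      rw [hdiv, sub_self, add_zero] at hmul
      rw [hmul] at hlt
      have hmod := S.epsSum_inj (Nat.mod_lt _ S.q_pos) (Nat.mod_lt _ S.q_pos) hlt
      rw [← Nat.mod_add_div k S.q, ← Nat.mod_add_div l S.q, hmod, hdiv]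

lemma u_injective [IsUltrametricDist K] [Fact p.Prime] : Function.Injective S.u :=
  fun k l h => S.eq_of_norm_u_sub_u_le k l (by simp [h])

/-- Induction on N with 𝔭 ^ N x ∈ 𝒪: a lattice point near 𝔭x supplies the higher digits, and the
residue class of the error supplies the lowest digit. -/
lemma exists_norm_sub_u_le [Fact p.Prime] (x : K) : ∃ k, ‖x - S.u k‖ ≤ 1 := by
  have hpos : 0 < ‖S.prime‖ := norm_pos_iff.mpr S.prime_ne_zero
  have key : ∀ N : ℕ, ∀ x : K, ‖S.prime ^ N * x‖ ≤ 1 → ∃ k, ‖x - S.u k‖ ≤ 1 := by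
    intro N
    induction N with
    | zero => exact fun x hx => ⟨0, by simpa using hx⟩
    | succ N ih =>
      intro x hx
      obtain ⟨n, hn⟩ := ih (S.prime * x) (by rwa [← mul_assoc, ← pow_succ])
      obtain ⟨b, hb, hb'⟩ := S.exists_epsSum hn
      refine ⟨b + S.q * n, ?_⟩
      -- There is no norm strictly between ‖𝔭‖ and 1, so the error is divisible by 𝔭 in 𝒪.
      have hle := S.prime_max _ hb'
      have heq : S.prime * x - S.u n - S.epsSum b = S.prime * (x - S.u (b + S.q * n)) := by
        have := S.prime_ne_zero
        rw [S.u_add_mul hb, uDigit_eq]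
        field_simp
        ring
      rw [heq, norm_mul] at hle
      exact le_of_mul_le_mul_left (by simpa using hle) hpos
  obtain ⟨N, hN⟩ := exists_pow_lt_of_lt_one (y := ‖S.prime‖) (x := (‖x‖ + 1)⁻¹)
    (by positivity) S.prime_lt_one
  refine key N x ?_
  rw [norm_mul, norm_pow]
  have h1 : ‖S.prime‖ ^ N * (‖x‖ + 1) ≤ 1 := by
    have h2 := mul_le_mul_of_nonneg_right hN.le (show 0 ≤ ‖x‖ + 1 by positivity)
    rwa [inv_mul_cancel₀ (by positivity)] at h2
  nlinarith [pow_nonneg hpos.le N]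

/-- The exponents are at least 1, so a product of two generators has exponent at least 2, which is
the range covered by `chi_normalized`. -/
lemma u_mem_closure (n : ℕ) : S.u n ∈
    AddSubmonoid.closure {x : K | ∃ (i : Fin S.deg) (m : ℕ), 1 ≤ m ∧ x = S.eps i * S.prime⁻¹ ^ m} := by
  refine AddSubmonoid.sum_mem _ fun k _ => ?_
  rw [uDigit, Finset.sum_mul, Finset.sum_mul]
  refine AddSubmonoid.sum_mem _ fun i _ => ?_
  rw [mul_assoc, mul_assoc, ← nsmul_eq_mul]
  refine AddSubmonoid.nsmul_mem _ (AddSubmonoid.subset_closure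
    (show _ ∈ {x : K | ∃ (i : Fin S.deg) (m : ℕ), 1 ≤ m ∧ x = S.eps i * S.prime⁻¹ ^ m} from
      ⟨i, k + 1, by omega, ?_⟩)) _
  rw [pow_succ']

lemma chi_u_mul_u (k l : ℕ) : S.chi (S.u k * S.u l) = 1 := by
  refine AddSubmonoid.closure_induction₂ (motive := fun x y _ _ => S.chi (x * y) = 1)
    ?_ ?_ ?_ ?_ ?_ (S.u_mem_closure k) (S.u_mem_closure l)
  · rintro _ _ ⟨i, m, hm, rfl⟩ ⟨j, n, hn, rfl⟩
    have := S.chi_normalized i j (m + n) (by omega)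
    rw [← this, pow_add]
    congr 1
    ring
  · simp
  · simp
  · intro x y z _ _ _ h1 h2
    rw [add_mul, AddChar.map_add_eq_mul, h1, h2, one_mul]
  · intro x y z _ _ _ h1 h2
    rw [mul_add, AddChar.map_add_eq_mul, h1, h2, one_mul]

/-- The annihilator of 𝒪 is 𝒪: if ‖y‖ > 1 then y⁻¹ ∈ 𝔓, so y𝒪 contains 𝔓⁻¹, where χ is nontrivial.
-/
lemma norm_le_one_of_chi_mul_eq_one {y : K} (h : ∀ x : K, ‖x‖ ≤ 1 → S.chi (y * x) = 1) :
    ‖y‖ ≤ 1 := by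
  by_contra! hy
  obtain ⟨x, hx, hne⟩ := S.chi_nontrivial
  have hy0 : y ≠ 0 := fun h0 => by simp [h0] at hy; linarith
  refine hne ?_
  have h1 := h (y⁻¹ * x) ?_
  · rwa [mul_inv_cancel_left₀ hy0] at h1
  · have hinv : ‖y⁻¹‖ ≤ ‖S.prime‖ := S.prime_max _ (by
      rw [norm_inv]; exact inv_lt_one_of_one_lt₀ hy)
    calc ‖y⁻¹ * x‖ = ‖y⁻¹‖ * ‖x‖ := norm_mul _ _
      _ ≤ ‖S.prime‖ * ‖x‖ := by gcongr
      _ ≤ 1 := by rwa [← norm_mul]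

/-- The addition of `ℕ` transported from the lattice `𝒵`. -/
lemma exists_shift [IsUltrametricDist K] [Fact p.Prime] [CharP K p] (j : ℕ) :
    ∃ e : ℕ ≃ ℕ, ∀ k, S.u (e k) = S.u j + S.u k := by
  choose add hadd using S.exists_u_add
  choose neg hneg using S.exists_u_neg
  refine ⟨⟨add j, add (neg j), fun k => S.u_injective ?_, fun k => S.u_injective ?_⟩,
    fun k => (hadd j k).symm⟩
  · rw [← hadd, ← hadd, ← hneg]; ring
  · rw [← hadd, ← hadd, ← hneg]; ring

lemma exists_negEquiv [IsUltrametricDist K] [Fact p.Prime] [CharP K p] :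
    ∃ e : ℕ ≃ ℕ, ∀ k, S.u (e k) = -S.u k := by
  choose neg hneg using S.exists_u_neg
  refine ⟨⟨neg, neg, fun k => S.u_injective ?_, fun k => S.u_injective ?_⟩,
    fun k => (hneg k).symm⟩
  · rw [← hneg, ← hneg]; ring
  · rw [← hneg, ← hneg]; ring

/-- The permutation of `ℕ` which corresponds to translation by `u(j)` on the lattice. -/
noncomputable def shift [IsUltrametricDist K] [Fact p.Prime] [CharP K p] (j : ℕ) : ℕ ≃ ℕ :=
  (S.exists_shift j).choose

lemma u_shift [IsUltrametricDist K] [Fact p.Prime] [CharP K p] (j k : ℕ) :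
    S.u (S.shift j k) = S.u j + S.u k :=
  (S.exists_shift j).choose_spec k

/-- The permutation of `ℕ` which corresponds to negation on the lattice. -/
noncomputable def negEquiv [IsUltrametricDist K] [Fact p.Prime] [CharP K p] : ℕ ≃ ℕ :=
  S.exists_negEquiv.choose

lemma u_negEquiv [IsUltrametricDist K] [Fact p.Prime] [CharP K p] (k : ℕ) :
    S.u (S.negEquiv k) = -S.u k :=
  S.exists_negEquiv.choose_spec k

end LatticeLemmas

end LocalFieldSetting

/-! ### Integrable functions orthogonal to a point-separating family of continuous functions -/

section Completeness

open Filter Topology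

variable {X : Type*} [TopologicalSpace X] [CompactSpace X] [MeasurableSpace X] [BorelSpace X]
  {ν : Measure X} {h : X → ℂ}

lemma MeasureTheory.Integrable.continuousMap_mul (hh : Integrable h ν) (g : C(X, ℂ)) :
    Integrable (fun x => g x * h x) ν :=
  hh.bdd_mul g.continuous.aestronglyMeasurable (ae_of_all _ fun x => g.norm_coe_le_norm x)

/-- The indicator of a closed set is a bounded pointwise limit of continuous functions, so dominated
convergence makes all integrals of h over closed sets vanish. -/
lemma ae_eq_zero_of_forall_integral_continuousMap_mul [HasOuterApproxClosed X]
    (hh : Integrable h ν) (H : ∀ g : C(X, ℂ), ∫ x, g x * h x ∂ν = 0) : h =ᵐ[ν] 0 := by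
  refine ae_eq_zero_of_forall_setIntegral_isClosed_eq_zero hh fun s hs => ?_
  rw [← integral_indicator hs.measurableSet]
  have hlim : Tendsto (fun n => ∫ x, ((hs.apprSeq n x : ℝ) : ℂ) * h x ∂ν) atTop
      (𝓝 (∫ x, s.indicator h x ∂ν)) := by
    refine tendsto_integral_of_dominated_convergence (fun x => ‖h x‖) (fun n => ?_) hh.norm
      (fun n => ae_of_all _ fun x => ?_) (ae_of_all _ fun x => ?_)
    · exact (Complex.continuous_ofReal.comp (NNReal.continuous_coe.comp
        (hs.apprSeq n).continuous)).aestronglyMeasurable.mul hh.1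
    · rw [norm_mul]
      refine mul_le_of_le_one_left (norm_nonneg _) ?_
      simpa using HasOuterApproxClosed.apprSeq_apply_le_one hs n x
    · have h1 := tendsto_pi_nhds.mp (HasOuterApproxClosed.tendsto_apprSeq hs) x
      have h2 := ((Complex.continuous_ofReal.comp NNReal.continuous_coe).tendsto _).comp h1
      have hval : s.indicator h x =
          ((s.indicator (fun _ => (1 : NNReal)) x : NNReal) : ℂ) * h x := by
        by_cases hx : x ∈ s <;> simp [hx]
      rw [hval]
      exact h2.mul_const (h x)
  have hzero : ∀ n, ∫ x, ((hs.apprSeq n x : ℝ) : ℂ) * h x ∂ν = 0 := fun n =>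
    H ⟨fun x => ((hs.apprSeq n x : ℝ) : ℂ), Complex.continuous_ofReal.comp
      (NNReal.continuous_coe.comp (hs.apprSeq n).continuous)⟩
  simp_rw [hzero] at hlim
  exact tendsto_nhds_unique hlim tendsto_const_nhds

lemma ae_eq_zero_of_forall_integral_mul_of_separatesPoints [HasOuterApproxClosed X]
    {ι : Type*} (c : ι → C(X, ℂ)) (hone : ∃ i, c i = 1) (hmul : ∀ i j, ∃ k, c i * c j = c k)
    (hstar : ∀ i, ∃ k, star (c i) = c k) (hsep : ∀ x y, (∀ i, c i x = c i y) → x = y)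
    (hh : Integrable h ν) (H : ∀ i, ∫ x, c i x * h x ∂ν = 0) : h =ᵐ[ν] 0 := by
  let A : StarSubalgebra ℂ C(X, ℂ) :=
    { toSubalgebra := Algebra.adjoin ℂ (Set.range c)
      star_mem' := by
        change Algebra.adjoin ℂ (Set.range c) ≤ star (Algebra.adjoin ℂ (Set.range c))
        refine Algebra.adjoin_le ?_
        rintro - ⟨i, rfl⟩
        obtain ⟨k, hk⟩ := hstar i
        exact Algebra.subset_adjoin ⟨k, hk.symm⟩ }
  -- The family contains 1 and is closed under products, so the algebra it generates is only its
  -- linear span, on which the hypothesis applies.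
  have hA : Subalgebra.toSubmodule A.toSubalgebra = Submodule.span ℂ (Set.range c) := by
    apply Algebra.adjoin_eq_span_of_subset
    refine Set.Subset.trans ?_ Submodule.subset_span
    intro x hx
    refine Submonoid.closure_induction (fun _ => id) ?_ ?_ hx
    · exact hone
    · rintro - - - - ⟨i, rfl⟩ ⟨j, rfl⟩
      obtain ⟨k, hk⟩ := hmul i j
      exact ⟨k, hk.symm⟩
  have hdense : A.topologicalClosure = ⊤ := by
    refine ContinuousMap.starSubalgebra_topologicalClosure_eq_top_of_separatesPoints A ?_
    intro x y hxy
    by_contra! hne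
    exact hxy (hsep x y fun i => hne _ ⟨c i, Algebra.subset_adjoin ⟨i, rfl⟩, rfl⟩)
  -- Integration against h is continuous in the sup norm, so its kernel is closed and
  -- Stone–Weierstrass extends the vanishing to all of C(X, ℂ).
  let Λ : C(X, ℂ) →L[ℂ] ℂ := LinearMap.mkContinuous
    { toFun := fun g => ∫ x, g x * h x ∂ν
      map_add' := fun f g => by
        simp only [ContinuousMap.add_apply, add_mul]
        exact integral_add (hh.continuousMap_mul f) (hh.continuousMap_mul g)
      map_smul' := fun r g => by
        simp only [ContinuousMap.smul_apply, smul_eq_mul, mul_assoc, RingHom.id_apply]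
        exact integral_const_mul _ _ } (∫ x, ‖h x‖ ∂ν) fun g => by
      rw [mul_comm, ← integral_const_mul]
      refine (norm_integral_le_integral_norm _).trans
        (integral_mono (hh.continuousMap_mul g).norm (hh.norm.const_mul _) fun x => ?_)
      rw [norm_mul]
      exact mul_le_mul_of_nonneg_right (g.norm_coe_le_norm x) (norm_nonneg _)
  have hker : (A : Set C(X, ℂ)) ⊆ (Λ.ker : Set C(X, ℂ)) := by
    have h1 : Submodule.span ℂ (Set.range c) ≤ Λ.ker := by
      rw [Submodule.span_le]
      rintro - ⟨i, rfl⟩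
      exact H i
    rw [← hA] at h1
    exact h1
  refine ae_eq_zero_of_forall_integral_continuousMap_mul hh fun g => ?_
  have hg : g ∈ A.topologicalClosure := hdense ▸ trivial
  exact closure_minimal hker Λ.isClosed_ker hg

end Completeness

namespace LocalFieldSetting

/-! ### The tiling of K by the cells u(k) + 𝒪, and characters on one cell -/

section Cells

variable {K : Type*} [NontriviallyNormedField K] [IsUltrametricDist K]
  {p : ℕ} [Fact p.Prime] [CharP K p] (S : LocalFieldSetting K p)

/-- The cell `u(k) + 𝒪`. -/
def cell (k : ℕ) : Set K := Metric.closedBall (S.u k) 1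

lemma mem_cell {k : ℕ} {x : K} : x ∈ S.cell k ↔ ‖x - S.u k‖ ≤ 1 := by
  rw [cell, mem_closedBall_iff_norm]

lemma eq_of_mem_cell {k l : ℕ} {x : K} (hk : x ∈ S.cell k) (hl : x ∈ S.cell l) : k = l := by
  refine S.eq_of_norm_u_sub_u_le k l ?_
  rw [mem_cell] at hk hl
  have := norm_sub_le_of_le_of_le hl hk
  rwa [sub_sub_sub_cancel_left] at this

lemma pairwise_disjoint_cell : Pairwise (Function.onFun Disjoint S.cell) := fun _ _ hkl =>
  Set.disjoint_left.mpr fun _ hk hl => hkl (S.eq_of_mem_cell hk hl)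

lemma iUnion_cell : ⋃ k, S.cell k = Set.univ := by
  refine Set.eq_univ_of_forall fun x => ?_
  obtain ⟨k, hk⟩ := S.exists_norm_sub_u_le x
  exact Set.mem_iUnion.mpr ⟨k, S.mem_cell.mpr hk⟩

lemma measurableSet_cell [MeasurableSpace K] [BorelSpace K] (k : ℕ) : MeasurableSet (S.cell k) :=
  Metric.isClosed_closedBall.measurableSet

/-- Triviality on 𝒪 makes χ locally constant. -/
lemma continuous_chi : Continuous S.chi := by
  refine continuous_iff_continuousAt.mpr fun x => ?_
  refine (continuousAt_const (y := S.chi x)).congr ?_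
  filter_upwards [Metric.closedBall_mem_nhds x one_pos] with y hy
  rw [mem_closedBall_iff_norm] at hy
  rw [← sub_add_cancel y x, AddChar.map_add_eq_mul, S.chi_trivial _ hy, one_mul]

lemma chi_u_mul_add_u (k l : ℕ) (x : K) : S.chi (S.u k * (x + S.u l)) = S.chi (S.u k * x) := by
  rw [mul_add, AddChar.map_add_eq_mul, chi_u_mul_u, mul_one]

/-- The character `x ↦ χ(y x)` as a complex function. -/
noncomputable def char (y x : K) : ℂ := S.chi (y * x)

lemma continuous_char (y : K) : Continuous (S.char y) :=
  continuous_subtype_val.comp (S.continuous_chi.comp (continuous_const_mul y))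

@[simp] lemma norm_char (y x : K) : ‖S.char y x‖ = 1 := Circle.norm_coe _

@[simp] lemma char_zero_left (x : K) : S.char 0 x = 1 := by simp [char]

@[simp] lemma char_zero_right (x : K) : S.char x 0 = 1 := by simp [char]

lemma char_comm (x y : K) : S.char x y = S.char y x := by rw [char, mul_comm]; rfl

lemma char_add_left (x y z : K) : S.char (x + y) z = S.char x z * S.char y z := by
  simp [char, add_mul, AddChar.map_add_eq_mul]

lemma char_add_right (x y z : K) : S.char z (x + y) = S.char z x * S.char z y := by
  simp [char, mul_add, AddChar.map_add_eq_mul]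

lemma star_char (x y : K) : star (S.char x y) = S.char (-x) y := by
  rw [char, char, neg_mul, AddChar.map_neg_eq_inv, Circle.coe_inv_eq_conj]
  rfl

lemma char_neg_right (x y : K) : S.char x (-y) = S.char (-x) y := by simp [char]

lemma char_u_add_u (k l : ℕ) (x : K) : S.char (S.u k) (x + S.u l) = S.char (S.u k) x := by
  rw [char, chi_u_mul_add_u]; rfl

lemma char_u_u (k l : ℕ) : S.char (S.u k) (S.u l) = 1 := by simp [char, chi_u_mul_u]

/-- The character χ(·(x - y)) is trivial on 𝒵 by assumption and on 𝒪 because x - y ∈ 𝒪, hence on K =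
𝒵 + 𝒪; for x ≠ y this would make χ trivial. -/
lemma eq_of_forall_char_u_eq {x y : K} (hxy : ‖x - y‖ ≤ 1)
    (h : ∀ k, S.char (S.u k) x = S.char (S.u k) y) : x = y := by
  by_contra hne
  have hz : x - y ≠ 0 := sub_ne_zero.mpr hne
  have hu : ∀ k, S.chi (S.u k * (x - y)) = 1 := fun k => by
    rw [mul_sub, AddChar.map_sub_eq_div, Circle.coe_injective (h k), div_self']
  have hall : ∀ v, S.chi (v * (x - y)) = 1 := fun v => by
    obtain ⟨k, hk⟩ := S.exists_norm_sub_u_le v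
    rw [← sub_add_cancel v (S.u k), add_mul, AddChar.map_add_eq_mul, hu, mul_one]
    refine S.chi_trivial _ ?_
    rw [norm_mul]
    exact mul_le_one₀ hk (norm_nonneg _) hxy
  obtain ⟨v, -, hv⟩ := S.chi_nontrivial
  exact hv (by simpa [hz] using hall (v * (x - y)⁻¹))

variable [ProperSpace K] [MeasurableSpace K] [BorelSpace K] {μ : Measure K}

/-- The characters `χ(u(k) ·)` are complete on each ball of radius one. -/
lemma ae_eq_zero_of_forall_integral_char (a : K) {h : K → ℂ}
    (hh : IntegrableOn h (Metric.closedBall a 1) μ)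
    (H : ∀ k, ∫ x in Metric.closedBall a 1, S.char (S.u k) x * h x ∂μ = 0) :
    ∀ᵐ x ∂μ.restrict (Metric.closedBall a 1), h x = 0 := by
  set B := Metric.closedBall a 1
  have hB : MeasurableSet B := Metric.isClosed_closedBall.measurableSet
  have : CompactSpace B := isCompact_iff_compactSpace.mp (isCompact_closedBall a 1)
  have hmp : MeasurePreserving (Subtype.val : B → K) (μ.comap Subtype.val) (μ.restrict B) :=
    ⟨measurable_subtype_coe, map_comap_subtype_coe hB μ⟩
  have hemb : MeasurableEmbedding (Subtype.val : B → K) := MeasurableEmbedding.subtype_coe hB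
  -- Because 𝒵 is a group, these characters are closed under products and conjugation.
  have key : (fun x : B => h x) =ᵐ[μ.comap Subtype.val] 0 := by
    refine ae_eq_zero_of_forall_integral_mul_of_separatesPoints
      (fun k => (⟨fun x : B => S.char (S.u k) x,
        (S.continuous_char _).comp continuous_subtype_val⟩ : C(B, ℂ)))
      ⟨0, ?_⟩ (fun i j => ?_) (fun i => ?_) (fun x y hxy => ?_)
      ((hmp.integrable_comp_emb hemb).mpr hh) (fun k => ?_)
    · ext x; simp
    · obtain ⟨m, hm⟩ := S.exists_u_add i j
      refine ⟨m, ?_⟩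
      ext x
      simp [← hm, char_add_left]
    · obtain ⟨m, hm⟩ := S.exists_u_neg i
      refine ⟨m, ?_⟩
      ext x
      rw [ContinuousMap.star_apply]
      simp only [ContinuousMap.coe_mk, star_char, hm]
    · refine Subtype.ext (S.eq_of_forall_char_u_eq ?_ hxy)
      have hx := mem_closedBall_iff_norm.mp x.2
      have hy := mem_closedBall_iff_norm.mp y.2
      have := norm_sub_le_of_le_of_le hx hy
      rwa [sub_sub_sub_cancel_right] at this
    · rw [← H k]
      exact hmp.integral_comp hemb fun x => S.char (S.u k) x * h x
  rw [← map_comap_subtype_coe hB μ]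
  exact (hemb.ae_map_iff).mpr key

end Cells

/-! ### The Gabor basis and Plancherel's theorem -/

section Plancherel

variable {K : Type*} [NontriviallyNormedField K] [IsUltrametricDist K] [ProperSpace K]
  [MeasurableSpace K] [BorelSpace K] {p : ℕ} [Fact p.Prime] [CharP K p]
  (S : LocalFieldSetting K p) {μ : Measure K} [μ.IsAddHaarMeasure]

lemma measure_cell (hμ : μ (Metric.closedBall 0 1) = 1) (k : ℕ) : μ (S.cell k) = 1 := by
  rw [← hμ, ← measure_preimage_add_right μ (S.u k) (S.cell k)]
  congr 1
  ext x
  simp [mem_cell]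

lemma measure_cell_lt_top (k : ℕ) : μ (S.cell k) < ∞ := measure_closedBall_lt_top

instance isFiniteMeasure_restrict_cell (k : ℕ) : IsFiniteMeasure (μ.restrict (S.cell k)) :=
  isFiniteMeasure_restrict.mpr (S.measure_cell_lt_top k).ne

lemma ae_of_forall_ae_restrict_cell {P : K → Prop}
    (h : ∀ k, ∀ᵐ x ∂μ.restrict (S.cell k), P x) : ∀ᵐ x ∂μ, P x := by
  rw [← Measure.restrict_univ (μ := μ), ← S.iUnion_cell]
  exact (ae_restrict_iUnion_iff _ _).mpr h

lemma integrableOn_cell (f : Lp ℂ 2 μ) (k : ℕ) : IntegrableOn f (S.cell k) μ :=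
  ((Lp.memLp f).restrict _).integrable (by norm_num)

lemma integrableOn_char_mul {f : K → ℂ} {s : Set K} (hf : IntegrableOn f s μ) (y : K) :
    IntegrableOn (fun x => S.char y x * f x) s μ :=
  hf.bdd_mul (c := 1) (S.continuous_char y).aestronglyMeasurable (ae_of_all _ fun x => by simp)

/-- For y ∈ 𝒪 the integrand is constant on the cell, with its value at u(k). Otherwise some z ∈ 𝒪
has χ(yz) ≠ 1, and translating the cell by z multiplies the integral by this number. -/
lemma integral_char_cell (hμ : μ (Metric.closedBall 0 1) = 1) (k : ℕ) (y : K) :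
    ∫ x in S.cell k, S.char y x ∂μ = (Metric.closedBall 0 1).indicator (S.char (S.u k)) y := by
  by_cases hy : ‖y‖ ≤ 1
  · rw [Set.indicator_of_mem (by simpa using hy),
      setIntegral_congr_fun (g := fun _ => S.char (S.u k) y) (S.measurableSet_cell k)]
    · simp [Measure.real, S.measure_cell hμ]
    · intro x hx
      have h1 : S.chi (y * (x - S.u k)) = 1 := S.chi_trivial _ (by
        rw [norm_mul]
        exact mul_le_one₀ hy (norm_nonneg _) (S.mem_cell.mp hx))
      have h2 : S.char y (x - S.u k) = 1 := by simp [char, h1]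
      change S.char y x = _
      rw [← sub_add_cancel x (S.u k), char_add_right, h2, one_mul, char_comm]
  · rw [Set.indicator_of_notMem (by simpa using hy)]
    obtain ⟨z, hz, hne⟩ : ∃ z, ‖z‖ ≤ 1 ∧ S.chi (y * z) ≠ 1 := by
      by_contra! h
      exact hy (S.norm_le_one_of_chi_mul_eq_one h)
    have hne' : S.char y z ≠ 1 := fun h => hne (Circle.coe_injective (h.trans Circle.coe_one.symm))
    set I := ∫ x in S.cell k, S.char y x ∂μ with hI
    have hshift : I = S.char y z * I := by
      rw [hI, ← integral_const_mul, ← integral_indicator (S.measurableSet_cell k),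
        ← integral_indicator (S.measurableSet_cell k), ← integral_add_right_eq_self _ z]
      congr 1
      ext x
      have hiff : x + z ∈ S.cell k ↔ x ∈ S.cell k := by
        rw [mem_cell, mem_cell]
        constructor <;> intro h
        · simpa [add_sub_right_comm] using norm_sub_le_of_le_of_le h hz
        · have := norm_sub_le_of_le_of_le h (show ‖-z‖ ≤ 1 by rwa [norm_neg])
          simpa [add_sub_right_comm] using this
      by_cases hx : x ∈ S.cell k
      · rw [Set.indicator_of_mem hx, Set.indicator_of_mem (hiff.mpr hx), char_add_right, mul_comm]
      · rw [Set.indicator_of_notMem hx, Set.indicator_of_notMem (hiff.not.mpr hx)]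
    have h0 : (S.char y z - 1) * I = 0 := by rw [sub_mul, one_mul, ← hshift, sub_self]
    exact (mul_eq_zero.mp h0).resolve_left (sub_ne_zero.mpr hne')

/-- The character `χ(u(k) ·)` cut off to the cell `u(l) + 𝒪`, where `(k, l) = i`. -/
noncomputable def gaborFun (i : ℕ × ℕ) : K → ℂ := (S.cell i.2).indicator (S.char (S.u i.1))

lemma memLp_gaborFun (i : ℕ × ℕ) (r : ℝ≥0∞) : MemLp (S.gaborFun i) r μ := by
  rw [gaborFun, memLp_indicator_iff_restrict (S.measurableSet_cell _)]
  exact MemLp.of_bound (S.continuous_char _).aestronglyMeasurable 1 (ae_of_all _ fun x => by simp)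

variable (μ) in
/-- The Gabor system of `L²(K)` along the lattice. -/
noncomputable def gabor (i : ℕ × ℕ) : Lp ℂ 2 μ := (S.memLp_gaborFun i 2).toLp _

lemma coeFn_gabor (i : ℕ × ℕ) : S.gabor μ i =ᵐ[μ] S.gaborFun i := MemLp.coeFn_toLp _

lemma inner_gabor (i : ℕ × ℕ) (f : Lp ℂ 2 μ) :
    inner ℂ (S.gabor μ i) f = ∫ x in S.cell i.2, S.char (-S.u i.1) x * f x ∂μ := by
  rw [L2.inner_def, ← integral_indicator (S.measurableSet_cell _)]
  refine integral_congr_ae ?_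
  filter_upwards [S.coeFn_gabor i] with x hx
  rw [hx, gaborFun, RCLike.inner_apply]
  by_cases h : x ∈ S.cell i.2
  · rw [Set.indicator_of_mem h, Set.indicator_of_mem h, ← star_char, mul_comm]
    rfl
  · simp [Set.indicator_of_notMem h]

/-- Different cells are disjoint; within one cell the inner product is the integral of χ((u(k') -
u(k))·), and u(k') - u(k) ∈ 𝒪 only for k = k'. -/
lemma orthonormal_gabor (hμ : μ (Metric.closedBall 0 1) = 1) : Orthonormal ℂ (S.gabor μ) := by
  rw [orthonormal_iff_ite]
  rintro ⟨k, l⟩ ⟨k', l'⟩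
  rw [inner_gabor]
  have hcongr : ∫ x in S.cell l, S.char (-S.u k) x * S.gabor μ (k', l') x ∂μ =
      ∫ x in S.cell l, S.char (-S.u k) x * S.gaborFun (k', l') x ∂μ := by
    refine integral_congr_ae (ae_restrict_of_ae ?_)
    filter_upwards [S.coeFn_gabor (k', l')] with x hx
    rw [hx]
  rw [hcongr]
  by_cases hl : l = l'
  · subst hl
    rw [setIntegral_congr_fun (g := S.char (S.u k' - S.u k)) (S.measurableSet_cell l),
      S.integral_char_cell hμ]
    · by_cases hk : k = k'
      · subst hk
        simp
      · rw [if_neg (by simpa using hk), Set.indicator_of_notMem]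
        intro h
        exact hk (S.eq_of_norm_u_sub_u_le _ _ (by simpa using h)).symm
    · intro x hx
      change S.char (-S.u k) x * (S.cell l).indicator (S.char (S.u k')) x = _
      rw [Set.indicator_of_mem hx, ← char_add_left, neg_add_eq_sub]
  · rw [if_neg (by simp [hl]), setIntegral_congr_fun (g := fun _ => 0) (S.measurableSet_cell l)]
    · simp
    · intro x hx
      have : x ∉ S.cell l' := fun h => hl (S.eq_of_mem_cell hx h)
      simp [gaborFun, this]

lemma eq_zero_of_forall_inner_gabor {f : Lp ℂ 2 μ} (h : ∀ i, inner ℂ (S.gabor μ i) f = 0) :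
    f = 0 := by
  rw [Lp.eq_zero_iff_ae_eq_zero]
  refine S.ae_of_forall_ae_restrict_cell fun l => ?_
  refine S.ae_eq_zero_of_forall_integral_char (S.u l) (S.integrableOn_cell f l) fun k => ?_
  have := h (S.negEquiv k, l)
  rw [inner_gabor, u_negEquiv, neg_neg] at this
  exact this

lemma orthogonal_span_gabor : (Submodule.span ℂ (Set.range (S.gabor μ)))ᗮ = ⊥ := by
  refine (Submodule.eq_bot_iff _).mpr fun f hf => S.eq_zero_of_forall_inner_gabor fun i => ?_
  exact (Submodule.mem_orthogonal _ _).mp hf _ (Submodule.subset_span ⟨i, rfl⟩)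

/-- The Gabor system as a Hilbert basis. -/
noncomputable def gaborBasis (hμ : μ (Metric.closedBall 0 1) = 1) :
    HilbertBasis (ℕ × ℕ) ℂ (Lp ℂ 2 μ) :=
  HilbertBasis.mkOfOrthogonalEqBot (S.orthonormal_gabor hμ) S.orthogonal_span_gabor

@[simp] lemma coe_gaborBasis (hμ : μ (Metric.closedBall 0 1) = 1) :
    ⇑(S.gaborBasis hμ) = S.gabor μ := by simp [gaborBasis]

/-- The action `(k, l) ↦ (-l, k)` of the Fourier transform on the index set of the Gabor basis. -/
noncomputable def rotate : ℕ × ℕ ≃ ℕ × ℕ :=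
  (Equiv.prodComm ℕ ℕ).trans (Equiv.prodCongr S.negEquiv (Equiv.refl ℕ))

lemma rotate_apply (k l : ℕ) : S.rotate (k, l) = (S.negEquiv l, k) := rfl

/-- The Gabor basis, reindexed by `rotate`. -/
noncomputable def rotatedBasis (hμ : μ (Metric.closedBall 0 1) = 1) :
    HilbertBasis (ℕ × ℕ) ℂ (Lp ℂ 2 μ) :=
  HilbertBasis.mkOfOrthogonalEqBot ((S.orthonormal_gabor hμ).comp _ S.rotate.injective) (by
    rw [S.rotate.surjective.range_comp]
    exact S.orthogonal_span_gabor)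

lemma rotatedBasis_apply (hμ : μ (Metric.closedBall 0 1) = 1) (i : ℕ × ℕ) :
    S.rotatedBasis hμ i = S.gabor μ (S.rotate i) := by simp [rotatedBasis]

/-- The Fourier transform as a unitary operator. -/
noncomputable def fourierEquiv (hμ : μ (Metric.closedBall 0 1) = 1) : Lp ℂ 2 μ ≃ₗᵢ[ℂ] Lp ℂ 2 μ :=
  (S.gaborBasis hμ).repr.trans (S.rotatedBasis hμ).repr.symm

lemma fourierEquiv_gabor (hμ : μ (Metric.closedBall 0 1) = 1) (i : ℕ × ℕ) :
    S.fourierEquiv hμ (S.gabor μ i) = S.gabor μ (S.rotate i) := by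
  classical
  have h := (S.gaborBasis hμ).repr_self i
  rw [coe_gaborBasis] at h
  rw [fourierEquiv, LinearIsometryEquiv.trans_apply, h, HilbertBasis.repr_symm_single,
    rotatedBasis_apply]

lemma fourierIntegral_eq (f : K → ℂ) (ξ : K) :
    Fourier.fourierIntegral S.chi μ f ξ = ∫ x, S.char (-ξ) x * f x ∂μ := by
  rw [Fourier.fourierIntegral_def]
  refine integral_congr_ae (ae_of_all _ fun x => ?_)
  simp only [Circle.smul_def, smul_eq_mul, char]
  congr 3
  ring

lemma continuous_mul_form : Continuous fun x : K × K => LinearMap.mul K K x.1 x.2 := continuous_mul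

lemma continuous_fourierIntegral {f : K → ℂ} (hf : Integrable f μ) :
    Continuous (Fourier.fourierIntegral S.chi μ f) :=
  VectorFourier.fourierIntegral_continuous S.continuous_chi continuous_mul_form hf

/-- Integrating χ((u(k) - ξ)·) over the cell of u(l) leaves χ(u(l)(u(k) - ξ)) for ξ in the cell of
u(k). The phase χ(u(l)u(k)) is 1, so the result is again a member of the system, without a factor.
-/
lemma fourierIntegral_gaborFun (hμ : μ (Metric.closedBall 0 1) = 1) (i : ℕ × ℕ) :
    Fourier.fourierIntegral S.chi μ (S.gaborFun i) = S.gaborFun (S.rotate i) := by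
  obtain ⟨k, l⟩ := i
  ext ξ
  have h1 : ∫ x, S.char (-ξ) x * S.gaborFun (k, l) x ∂μ =
      ∫ x in S.cell l, S.char (S.u k - ξ) x ∂μ := by
    rw [← integral_indicator (S.measurableSet_cell _)]
    congr 1
    ext x
    by_cases hx : x ∈ S.cell l
    · simp only [gaborFun, Set.indicator_of_mem hx]
      rw [← char_add_left, neg_add_eq_sub]
    · simp [gaborFun, Set.indicator_of_notMem hx]
  rw [fourierIntegral_eq, h1, S.integral_char_cell hμ, rotate_apply, gaborFun]
  have hiff : S.u k - ξ ∈ Metric.closedBall (0 : K) 1 ↔ ξ ∈ S.cell k := by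
    rw [mem_cell, mem_closedBall_zero_iff, norm_sub_rev]
  by_cases hx : ξ ∈ S.cell k
  · rw [Set.indicator_of_mem hx, Set.indicator_of_mem (hiff.mpr hx), u_negEquiv, sub_eq_add_neg,
      char_add_right, char_u_u, one_mul, char_neg_right]
  · rw [Set.indicator_of_notMem hx, Set.indicator_of_notMem (hiff.not.mpr hx)]

/-- Both sides are tested on each cell against all χ(u(l)·). For the unitary operator the integrals
come from its action on the basis, for the Fourier integral from moving the transform onto the Gabor
function; both equal the same Gabor coefficient of f. -/
lemma fourierEquiv_eq_fourierIntegral (hμ : μ (Metric.closedBall 0 1) = 1) (f : Lp ℂ 2 μ)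
    (hf : Integrable f μ) :
    S.fourierEquiv hμ f =ᵐ[μ] Fourier.fourierIntegral S.chi μ f := by
  have hcont := S.continuous_fourierIntegral hf
  refine S.ae_of_forall_ae_restrict_cell fun k => ?_
  have hint : IntegrableOn (Fourier.fourierIntegral S.chi μ f) (S.cell k) μ :=
    hcont.continuousOn.integrableOn_compact (isCompact_closedBall _ _)
  have hzero := S.ae_eq_zero_of_forall_integral_char (S.u k)
    ((S.integrableOn_cell (S.fourierEquiv hμ f) k).sub hint) fun l => ?_
  · filter_upwards [hzero] with x hx
    exact sub_eq_zero.mp hx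
  change ∫ x in S.cell k, _ ∂μ = 0
  simp only [Pi.sub_apply, mul_sub]
  rw [integral_sub (S.integrableOn_char_mul (S.integrableOn_cell _ k) _)
    (S.integrableOn_char_mul hint _), sub_eq_zero]
  have h1 := S.inner_gabor (S.rotate (k, l)) (S.fourierEquiv hμ f)
  rw [← S.fourierEquiv_gabor hμ, LinearIsometryEquiv.inner_map_map, inner_gabor, rotate_apply,
    u_negEquiv, neg_neg] at h1
  refine h1.symm.trans ?_
  have hflip := VectorFourier.integral_fourierIntegral_smul_eq_flip (μ := μ) (ν := μ)
    (L := LinearMap.mul K K) S.continuous_chi continuous_mul_form hf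
    (memLp_one_iff_integrable.mp (S.memLp_gaborFun (l, k) 1))
  have hL : (LinearMap.mul K K).flip = LinearMap.mul K K := by
    ext; simp
  rw [hL] at hflip
  change ∫ ξ, Fourier.fourierIntegral S.chi μ f ξ • S.gaborFun (l, k) ξ ∂μ =
    ∫ x, f x • Fourier.fourierIntegral S.chi μ (S.gaborFun (l, k)) x ∂μ at hflip
  rw [S.fourierIntegral_gaborFun hμ] at hflip
  rw [← integral_indicator (S.measurableSet_cell _), ← integral_indicator (S.measurableSet_cell _)]
  convert hflip.symm using 2
  · ext x
    by_cases hx : x ∈ S.cell l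
    · simp [gaborFun, rotate_apply, u_negEquiv, hx, mul_comm]
    · simp [gaborFun, rotate_apply, hx]
  · ext x
    by_cases hx : x ∈ S.cell k
    · simp [gaborFun, hx, mul_comm]
    · simp [gaborFun, hx]

/-- The Gabor functions are integrable and span a dense subspace. -/
lemma ext_of_forall_integrable (S : LocalFieldSetting K p) (hμ : μ (Metric.closedBall 0 1) = 1)
    {A B : Lp ℂ 2 μ →L[ℂ] Lp ℂ 2 μ}
    (h : ∀ f : Lp ℂ 2 μ, Integrable f μ → A f = B f) : A = B := by
  refine ContinuousLinearMap.ext_on (s := Set.range (S.gabor μ)) ?_ ?_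
  · have := (S.gaborBasis hμ).dense_span
    rw [coe_gaborBasis] at this
    exact Submodule.dense_iff_topologicalClosure_eq_top.mpr this
  · rintro - ⟨i, rfl⟩
    exact h _ ((memLp_one_iff_integrable.mp (S.memLp_gaborFun i 1)).congr (S.coeFn_gabor i).symm)

lemma fourier_spec (hμ : μ (Metric.closedBall 0 1) = 1) (f : Lp ℂ 2 μ) (hf : Integrable f μ) :
    S.fourier μ f =ᵐ[μ] Fourier.fourierIntegral S.chi μ f := by
  have hex : ∃ F : Lp ℂ 2 μ →L[ℂ] Lp ℂ 2 μ, ∀ f : Lp ℂ 2 μ, Integrable f μ →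
      F f =ᵐ[μ] Fourier.fourierIntegral S.chi μ f :=
    ⟨(S.fourierEquiv hμ).toContinuousLinearEquiv, S.fourierEquiv_eq_fourierIntegral hμ⟩
  rw [fourier, dif_pos hex]
  exact hex.choose_spec f hf

/-- Plancherel's theorem. -/
lemma fourier_eq (hμ : μ (Metric.closedBall 0 1) = 1) (f : Lp ℂ 2 μ) :
    S.fourier μ f = S.fourierEquiv hμ f := by
  have h : S.fourier μ = ((S.fourierEquiv hμ).toContinuousLinearEquiv : Lp ℂ 2 μ →L[ℂ] Lp ℂ 2 μ) :=
    S.ext_of_forall_integrable hμ fun f hf => Lp.ext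
      ((S.fourier_spec hμ f hf).trans (S.fourierEquiv_eq_fourierIntegral hμ f hf).symm)
  rw [h]
  rfl

end Plancherel

/-! ### Translations become modulations -/

section Modulation

variable {K : Type*} [NontriviallyNormedField K] [IsUltrametricDist K] [ProperSpace K]
  [MeasurableSpace K] [BorelSpace K] {p : ℕ} [Fact p.Prime] [CharP K p]
  (S : LocalFieldSetting K p) {μ : Measure K} [μ.IsAddHaarMeasure]

lemma memLp_char_mul (y : K) {f : K → ℂ} (hf : MemLp f 2 μ) :
    MemLp (fun x => S.char y x * f x) 2 μ :=
  hf.of_le ((S.continuous_char y).aestronglyMeasurable.mul hf.1) (ae_of_all _ fun x => by simp)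

variable (μ) in
/-- Multiplication by the character `χ(y ·)` on `L²(K)`. -/
noncomputable def modulate (y : K) : Lp ℂ 2 μ →ₗᵢ[ℂ] Lp ℂ 2 μ where
  toFun f := (S.memLp_char_mul y (Lp.memLp f)).toLp _
  map_add' f g := by
    rw [← MemLp.toLp_add]
    refine MemLp.toLp_congr _ _ ?_
    filter_upwards [Lp.coeFn_add f g] with x hx
    rw [hx, Pi.add_apply, Pi.add_apply, mul_add]
  map_smul' r f := by
    rw [RingHom.id_apply, ← MemLp.toLp_const_smul]
    refine MemLp.toLp_congr _ _ ?_
    filter_upwards [Lp.coeFn_smul r f] with x hx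
    rw [hx, Pi.smul_apply, Pi.smul_apply, mul_smul_comm]
  norm_map' f := by
    change ‖(S.memLp_char_mul y (Lp.memLp f)).toLp _‖ = ‖f‖
    rw [Lp.norm_toLp, Lp.norm_def]
    congr 1
    exact eLpNorm_congr_norm_ae (ae_of_all _ fun x => by simp)

lemma coeFn_modulate (y : K) (f : Lp ℂ 2 μ) :
    S.modulate μ y f =ᵐ[μ] fun x => S.char y x * f x :=
  MemLp.coeFn_toLp (S.memLp_char_mul y (Lp.memLp f))

lemma coeFn_translate (a : K) (f : Lp ℂ 2 μ) :
    translate μ a f =ᵐ[μ] fun x => f (x - a) :=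
  Lp.coeFn_compMeasurePreserving f (measurePreserving_sub_right μ a)

lemma fourier_translate (hμ : μ (Metric.closedBall 0 1) = 1) (a : K) (f : Lp ℂ 2 μ) :
    S.fourier μ (translate μ a f) = S.modulate μ (-a) (S.fourier μ f) := by
  have h : (S.fourier μ).comp (translate μ a).toContinuousLinearMap =
      (S.modulate μ (-a)).toContinuousLinearMap.comp (S.fourier μ) := by
    refine S.ext_of_forall_integrable hμ fun f hf => Lp.ext ?_
    have hint : Integrable (translate μ a f) μ :=
      (hf.comp_sub_right a).congr (coeFn_translate a f).symm
    filter_upwards [S.fourier_spec hμ _ hint, S.fourier_spec hμ f hf,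
      S.coeFn_modulate (-a) (S.fourier μ f)] with ξ h1 h2 h3
    change S.fourier μ (translate μ a f) ξ = S.modulate μ (-a) (S.fourier μ f) ξ
    rw [h1, h3, h2, fourierIntegral_eq, fourierIntegral_eq, ← integral_const_mul,
      ← integral_add_right_eq_self _ a]
    refine integral_congr_ae ?_
    have h4 := (measurePreserving_add_right μ a).quasiMeasurePreserving.ae
      (coeFn_translate a f)
    filter_upwards [h4] with x hx
    rw [hx, add_sub_cancel_right, char_add_right, char_comm S (-ξ) a, char_neg_right]
    ring
  exact congrArg (fun A => A f) h

lemma inner_fourier (hμ : μ (Metric.closedBall 0 1) = 1) (f g : Lp ℂ 2 μ) :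
    inner ℂ (S.fourier μ f) (S.fourier μ g) = inner ℂ f g := by
  rw [S.fourier_eq hμ, S.fourier_eq hμ, LinearIsometryEquiv.inner_map_map]

lemma norm_fourier (hμ : μ (Metric.closedBall 0 1) = 1) (f : Lp ℂ 2 μ) :
    ‖S.fourier μ f‖ = ‖f‖ := by
  rw [S.fourier_eq hμ, LinearIsometryEquiv.norm_map]

lemma enorm_sq_eq_lintegral (f : Lp ℂ 2 μ) : ‖f‖ₑ ^ 2 = ∫⁻ x, ‖f x‖ₑ ^ 2 ∂μ := by
  rw [Lp.enorm_def, eLpNorm_eq_lintegral_rpow_enorm_toReal (by norm_num) (by norm_num),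
    ← ENNReal.rpow_natCast, ← ENNReal.rpow_mul]
  simp

end Modulation

/-! ### Fiberization: periodization over 𝒵, isometry, convergence and orthogonality -/

section Fibers

variable {K : Type*} [NontriviallyNormedField K] [IsUltrametricDist K] [ProperSpace K]
  [MeasurableSpace K] [BorelSpace K] {p : ℕ} [Fact p.Prime] [CharP K p]
  (S : LocalFieldSetting K p) {μ : Measure K} [μ.IsAddHaarMeasure]

lemma ae_comp_add_u {P : K → Prop} (h : ∀ᵐ x ∂μ, P x) : ∀ᵐ ξ ∂μ, ∀ k, P (ξ + S.u k) :=
  ae_all_iff.mpr fun k => (measurePreserving_add_right μ (S.u k)).quasiMeasurePreserving.ae h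

lemma aemeasurable_comp_add {G : K → ℝ≥0∞} (hG : AEMeasurable G μ) (a : K) :
    AEMeasurable (fun x => G (x + a)) μ :=
  hG.comp_quasiMeasurePreserving (measurePreserving_add_right μ a).quasiMeasurePreserving

lemma image_add_cell (k j : ℕ) : (fun x => x + S.u k) ⁻¹' S.cell (S.shift j k) = S.cell j := by
  ext x
  rw [Set.mem_preimage, mem_cell, mem_cell, u_shift]
  congr! 2
  ring

lemma lintegral_cell_comp_add (G : K → ℝ≥0∞) (j k : ℕ) :
    ∫⁻ x in S.cell j, G (x + S.u k) ∂μ = ∫⁻ x in S.cell (S.shift j k), G x ∂μ := by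
  rw [← S.image_add_cell k j]
  exact (measurePreserving_add_right μ (S.u k)).setLIntegral_comp_preimage_emb
    (MeasurableEquiv.addRight (S.u k)).measurableEmbedding _ _

/-- The 𝒵-translates of any one cell tile K; `shift` only reorders them. -/
lemma lintegral_cell_tsum {G : K → ℝ≥0∞} (hG : AEMeasurable G μ) (j : ℕ) :
    ∫⁻ x in S.cell j, ∑' k, G (x + S.u k) ∂μ = ∫⁻ x, G x ∂μ := by
  rw [lintegral_tsum fun k => (aemeasurable_comp_add hG _).restrict]
  simp_rw [S.lintegral_cell_comp_add G j]
  rw [(S.shift j).tsum_eq (fun k => ∫⁻ x in S.cell k, G x ∂μ),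
    ← lintegral_iUnion S.measurableSet_cell S.pairwise_disjoint_cell, S.iUnion_cell,
    Measure.restrict_univ]

lemma integral_cell_comp_add (G : K → ℂ) (j k : ℕ) :
    ∫ x in S.cell j, G (x + S.u k) ∂μ = ∫ x in S.cell (S.shift j k), G x ∂μ := by
  rw [← S.image_add_cell k j]
  exact (measurePreserving_add_right μ (S.u k)).setIntegral_preimage_emb
    (MeasurableEquiv.addRight (S.u k)).measurableEmbedding _ _

lemma integrableOn_periodization {G h : K → ℂ} (hG : Integrable G μ)
    (hh : ∀ᵐ ξ ∂μ, HasSum (fun k => G (ξ + S.u k)) (h ξ)) (j : ℕ) :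
    IntegrableOn h (S.cell j) μ := by
  refine ⟨?_, ?_⟩
  · refine aestronglyMeasurable_of_tendsto_ae (u := Filter.atTop)
      (f := fun s : Finset ℕ => fun ξ => ∑ k ∈ s, G (ξ + S.u k)) (fun s => ?_)
      (ae_restrict_of_ae hh)
    exact (Finset.aestronglyMeasurable_fun_sum s fun k _ => (hG.comp_add_right (S.u k)).1).restrict
  · have hle : ∫⁻ ξ in S.cell j, ‖h ξ‖ₑ ∂μ ≤ ∫⁻ ξ in S.cell j, ∑' k, ‖G (ξ + S.u k)‖ₑ ∂μ := by
      refine lintegral_mono_ae (ae_restrict_of_ae ?_)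
      filter_upwards [hh] with ξ hξ
      rw [← hξ.tsum_eq]
      exact enorm_tsum_le_tsum_enorm
    rw [S.lintegral_cell_tsum hG.1.enorm] at hle
    exact hle.trans_lt hG.2

lemma integral_periodization {G h : K → ℂ} (hG : Integrable G μ)
    (hh : ∀ᵐ ξ ∂μ, HasSum (fun k => G (ξ + S.u k)) (h ξ)) (j : ℕ) :
    ∫ ξ in S.cell j, h ξ ∂μ = ∫ x, G x ∂μ := by
  have h1 : ∫ ξ in S.cell j, h ξ ∂μ = ∫ ξ in S.cell j, ∑' k, G (ξ + S.u k) ∂μ := by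
    refine integral_congr_ae (ae_restrict_of_ae ?_)
    filter_upwards [hh] with ξ hξ using hξ.tsum_eq.symm
  rw [h1, integral_tsum (fun k => (hG.comp_add_right (S.u k)).1.restrict)]
  · simp_rw [S.integral_cell_comp_add G j]
    rw [(S.shift j).tsum_eq (fun k => ∫ x in S.cell k, G x ∂μ)]
    have := hasSum_integral_iUnion (μ := μ) (f := G) S.measurableSet_cell S.pairwise_disjoint_cell
      hG.integrableOn
    rw [this.tsum_eq, S.iUnion_cell, setIntegral_univ]
  · rw [← lintegral_tsum fun k => (aemeasurable_comp_add hG.1.enorm _).restrict,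
      S.lintegral_cell_tsum hG.1.enorm]
    exact hG.2.ne

lemma ae_tsum_enorm_sq_ne_top (f : Lp ℂ 2 μ) :
    ∀ᵐ ξ ∂μ, ∑' k, ‖f (ξ + S.u k)‖ₑ ^ 2 ≠ ∞ := by
  have hm : AEMeasurable (fun x => ‖f x‖ₑ ^ 2) μ := (Lp.aestronglyMeasurable f).enorm.pow_const 2
  refine S.ae_of_forall_ae_restrict_cell fun j => ?_
  have h := S.lintegral_cell_tsum hm j
  rw [← enorm_sq_eq_lintegral] at h
  refine (ae_lt_top' ?_ ?_).mono fun x hx => hx.ne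
  · exact AEMeasurable.tsum fun k => (aemeasurable_comp_add hm _).restrict
  · rw [h]
    exact ENNReal.pow_ne_top enorm_ne_top

lemma memℓp_two_iff {a : ℕ → ℂ} : Memℓp a 2 ↔ ∑' k, ‖a k‖ₑ ^ 2 ≠ ∞ := by
  rw [memℓp_gen_iff (by norm_num)]
  have h : ∀ k, ‖a k‖ₑ ^ 2 = ((‖a k‖₊ ^ 2 : NNReal) : ℝ≥0∞) := fun k => by
    rw [enorm_eq_nnnorm]; norm_cast
  simp_rw [h]
  rw [ENNReal.tsum_coe_ne_top_iff_summable, ← NNReal.summable_coe]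
  simp

lemma enorm_sq_lp (a : lp (fun _ : ℕ => ℂ) 2) : ‖a‖ₑ ^ 2 = ∑' k, ‖a k‖ₑ ^ 2 := by
  have h := lp.hasSum_norm (p := 2) (by norm_num) a
  have h' : HasSum (fun k => ‖a k‖ ^ 2) (‖a‖ ^ 2) := by simpa using h
  have h2 : ∀ x : ℂ, ‖x‖ₑ ^ 2 = ENNReal.ofReal (‖x‖ ^ 2) := fun x => by
    rw [ENNReal.ofReal_pow (norm_nonneg _), ofReal_norm]
  simp_rw [h2]
  rw [← ENNReal.ofReal_tsum_of_nonneg (fun k => by positivity) h'.summable, h'.tsum_eq,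
    ENNReal.ofReal_pow (norm_nonneg _), ofReal_norm]

lemma fiber_apply (f : Lp ℂ 2 μ) :
    ∀ᵐ ξ ∂μ, ∀ k, S.fiber f ξ k = S.fourier μ f (ξ + S.u k) := by
  filter_upwards [S.ae_tsum_enorm_sq_ne_top (S.fourier μ f)] with ξ hξ k
  rw [fiber, dif_pos (memℓp_two_iff.mpr hξ)]

lemma fiber_eq_of_fourier_eq {f g h : Lp ℂ 2 μ} {r s : ℂ}
    (H : S.fourier μ f = r • S.fourier μ g + s • S.fourier μ h) :
    ∀ᵐ ξ ∂μ, S.fiber f ξ = r • S.fiber g ξ + s • S.fiber h ξ := by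
  filter_upwards [S.fiber_apply f, S.fiber_apply g, S.fiber_apply h,
    S.ae_comp_add_u (Lp.coeFn_add (r • S.fourier μ g) (s • S.fourier μ h)),
    S.ae_comp_add_u (Lp.coeFn_smul r (S.fourier μ g)),
    S.ae_comp_add_u (Lp.coeFn_smul s (S.fourier μ h))] with ξ h1 h2 h3 h4 h5 h6
  ext k
  change S.fiber f ξ k = r * S.fiber g ξ k + s * S.fiber h ξ k
  rw [h1, H, h4, Pi.add_apply, h5, h6, h2, h3]
  rfl

lemma fiber_add (f g : Lp ℂ 2 μ) : ∀ᵐ ξ ∂μ, S.fiber (f + g) ξ = S.fiber f ξ + S.fiber g ξ := by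
  simpa using S.fiber_eq_of_fourier_eq (f := f + g) (g := f) (h := g) (r := 1) (s := 1) (by simp)

lemma fiber_sub (f g : Lp ℂ 2 μ) : ∀ᵐ ξ ∂μ, S.fiber (f - g) ξ = S.fiber f ξ - S.fiber g ξ := by
  simpa [sub_eq_add_neg] using
    S.fiber_eq_of_fourier_eq (f := f - g) (g := f) (h := g) (r := 1) (s := -1)
      (by simp [sub_eq_add_neg])

lemma fiber_smul (r : ℂ) (f : Lp ℂ 2 μ) : ∀ᵐ ξ ∂μ, S.fiber (r • f) ξ = r • S.fiber f ξ := by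
  simpa using S.fiber_eq_of_fourier_eq (f := r • f) (g := f) (h := f) (r := r) (s := 0) (by simp)

lemma fiber_zero : ∀ᵐ ξ ∂μ, S.fiber (0 : Lp ℂ 2 μ) ξ = 0 := by
  simpa using S.fiber_smul 0 (0 : Lp ℂ 2 μ)

/-- The modulating character is 𝒵-periodic because χ(u(k)u(l)) = 1, so all coordinates of the fiber
get the same factor. -/
lemma fiber_T (hμ : μ (Metric.closedBall 0 1) = 1) (k : ℕ) (f : Lp ℂ 2 μ) :
    ∀ᵐ ξ ∂μ, S.fiber (S.T μ k f) ξ = S.char (-S.u k) ξ • S.fiber f ξ := by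
  obtain ⟨m, hm⟩ := S.exists_u_neg k
  filter_upwards [S.fiber_apply f, S.fiber_apply (S.T μ k f),
    S.ae_comp_add_u (S.coeFn_modulate (-S.u k) (S.fourier μ f))] with ξ h1 h2 h3
  ext l
  rw [h2, T, S.fourier_translate hμ, h3, hm, char_u_add_u, ← h1]
  rfl

lemma aemeasurable_enorm_fiber_sq (f : Lp ℂ 2 μ) :
    AEMeasurable (fun ξ => ‖S.fiber f ξ‖ₑ ^ 2) μ := by
  have hm : AEMeasurable (fun x => ‖S.fourier μ f x‖ₑ ^ 2) μ :=
    (Lp.aestronglyMeasurable _).enorm.pow_const 2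
  have hsum : AEMeasurable (fun ξ => ∑' k, ‖S.fourier μ f (ξ + S.u k)‖ₑ ^ 2) μ :=
    AEMeasurable.tsum fun k => aemeasurable_comp_add hm (S.u k)
  refine hsum.congr ?_
  filter_upwards [S.fiber_apply f] with ξ hξ
  simp_rw [enorm_sq_lp, hξ]

lemma lintegral_cell_enorm_fiber_sq (hμ : μ (Metric.closedBall 0 1) = 1) (f : Lp ℂ 2 μ) (j : ℕ) :
    ∫⁻ ξ in S.cell j, ‖S.fiber f ξ‖ₑ ^ 2 ∂μ = ‖f‖ₑ ^ 2 := by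
  have hm : AEMeasurable (fun x => ‖S.fourier μ f x‖ₑ ^ 2) μ :=
    (Lp.aestronglyMeasurable _).enorm.pow_const 2
  have h1 : ‖f‖ₑ = ‖S.fourier μ f‖ₑ := by rw [← ofReal_norm, ← ofReal_norm, S.norm_fourier hμ]
  rw [h1, enorm_sq_eq_lintegral, ← S.lintegral_cell_tsum hm j]
  refine lintegral_congr_ae (ae_restrict_of_ae ?_)
  filter_upwards [S.fiber_apply f] with ξ hξ
  simp_rw [enorm_sq_lp, hξ]

open Filter Topology in
/-- An `L²` limit of functions has, along a sequence, the limits of their fibers almost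
everywhere. -/
lemma exists_seq_tendsto_fiber (hμ : μ (Metric.closedBall 0 1) = 1) {A : Set (Lp ℂ 2 μ)}
    {f : Lp ℂ 2 μ} (hf : f ∈ closure A) :
    ∃ g : ℕ → Lp ℂ 2 μ, (∀ n, g n ∈ A) ∧
      ∀ᵐ ξ ∂μ, Tendsto (fun n => S.fiber (g n) ξ) atTop (𝓝 (S.fiber f ξ)) := by
  -- With summable squared errors the sum of the squared fiber distances has finite integral over a
  -- cell; it is thus finite almost everywhere and its terms tend to 0.
  obtain ⟨ε, hε, hsum⟩ := ENNReal.exists_pos_sum_of_countable (ε := 1) one_ne_zero ℕ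
  have hex : ∀ n, ∃ g ∈ A, ‖g - f‖ₑ ^ 2 ≤ ε n := fun n => by
    obtain ⟨g, hg, hd⟩ := Metric.mem_closure_iff.mp hf (Real.sqrt (ε n))
      (Real.sqrt_pos.mpr (hε n))
    refine ⟨g, hg, ?_⟩
    rw [dist_comm, dist_eq_norm] at hd
    rw [← ofReal_norm, ← ENNReal.ofReal_pow (norm_nonneg _), ← ENNReal.ofReal_coe_nnreal]
    refine ENNReal.ofReal_le_ofReal ?_
    rw [← Real.sq_sqrt (ε n).coe_nonneg]
    gcongr
  choose g hg hle using hex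
  refine ⟨g, hg, S.ae_of_forall_ae_restrict_cell fun j => ?_⟩
  have hfin : ∀ᵐ ξ ∂μ.restrict (S.cell j), ∑' n, ‖S.fiber (g n - f) ξ‖ₑ ^ 2 < ∞ := by
    refine ae_lt_top' (AEMeasurable.tsum fun n =>
      (S.aemeasurable_enorm_fiber_sq _).restrict) ?_
    rw [lintegral_tsum fun n => (S.aemeasurable_enorm_fiber_sq _).restrict]
    simp_rw [S.lintegral_cell_enorm_fiber_sq hμ]
    exact ((ENNReal.tsum_le_tsum hle).trans_lt (hsum.trans ENNReal.one_lt_top)).ne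
  filter_upwards [hfin, ae_restrict_of_ae (ae_all_iff.mpr fun n => S.fiber_sub (g n) f)]
    with ξ h1 h2
  have h3 := ENNReal.tendsto_atTop_zero_of_tsum_ne_top h1.ne
  have h4 : Tendsto (fun n => ‖S.fiber (g n - f) ξ‖ₑ) atTop (𝓝 0) := by
    have h5 := (ENNReal.continuous_rpow_const (y := (2 : ℝ)⁻¹)).tendsto 0 |>.comp h3
    simp only [Function.comp_def, ENNReal.zero_rpow_of_pos (show (0 : ℝ) < 2⁻¹ by norm_num)] at h5
    refine h5.congr fun n => ?_
    rw [← ENNReal.rpow_natCast, ← ENNReal.rpow_mul]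
    simp
  rw [tendsto_iff_edist_tendsto_0]
  refine h4.congr fun n => ?_
  rw [edist_eq_enorm_sub, h2]

/-- The fibers of `f` and `g` are orthogonal if `g` is orthogonal to all `T_k f`. -/
lemma inner_fiber_eq_zero (hμ : μ (Metric.closedBall 0 1) = 1) {f g : Lp ℂ 2 μ}
    (h : ∀ k, inner ℂ (S.T μ k f) g = 0) :
    ∀ᵐ ξ ∂μ, inner ℂ (S.fiber f ξ) (S.fiber g ξ) = 0 := by
  have hsum : ∀ k, ∀ᵐ ξ ∂μ, HasSum
      (fun l => inner ℂ (S.fourier μ (S.T μ k f) (ξ + S.u l)) (S.fourier μ g (ξ + S.u l)))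
      (S.char (S.u k) ξ * inner ℂ (S.fiber f ξ) (S.fiber g ξ)) := fun k => by
    filter_upwards [S.fiber_T hμ k f, S.fiber_apply (S.T μ k f), S.fiber_apply g]
      with ξ h1 h2 h3
    have h4 := lp.hasSum_inner (𝕜 := ℂ) (S.fiber (S.T μ k f) ξ) (S.fiber g ξ)
    simp only [h2, h3] at h4
    have h5 : starRingEnd ℂ (S.char (-S.u k) ξ) = S.char (S.u k) ξ := by
      rw [starRingEnd_apply, star_char, neg_neg]
    rwa [h1, inner_smul_left, h5] at h4
  have hint := fun k => L2.integrable_inner (𝕜 := ℂ) (S.fourier μ (S.T μ k f)) (S.fourier μ g)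
  refine S.ae_of_forall_ae_restrict_cell fun j => ?_
  -- Unfolding the periodization, the integral of the fiber inner product against χ(u(k)·) over a
  -- cell is ⟨T_k f, g⟩ = 0, and these characters are complete there.
  refine S.ae_eq_zero_of_forall_integral_char (S.u j) ?_ fun k => ?_
  · have := S.integrableOn_periodization (hint 0) (hsum 0) j
    simp only [u_zero, char_zero_left, one_mul] at this
    exact this
  · have := S.integral_periodization (hint k) (hsum k) j
    rw [← L2.inner_def, S.inner_fourier hμ, h] at this
    exact this

end Fibers

end LocalFieldSetting

/-! ### Sums of squared norms, and projections -/

section NormSums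

lemma enorm_sq_eq_ofReal {E : Type*} [SeminormedAddGroup E] (x : E) :
    ‖x‖ₑ ^ 2 = ENNReal.ofReal (‖x‖ ^ 2) := by
  rw [ENNReal.ofReal_pow (norm_nonneg _), ofReal_norm]

lemma hasSum_of_tsum_ofReal_eq {ι : Type*} {a : ι → ℝ} {b : ℝ} (ha : ∀ i, 0 ≤ a i) (hb : 0 ≤ b)
    (h : ∑' i, ENNReal.ofReal (a i) = ENNReal.ofReal b) : HasSum a b := by
  have hs : Summable a := by
    have h1 := ENNReal.summable_toReal (f := fun i => ENNReal.ofReal (a i))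
      (by rw [h]; exact ENNReal.ofReal_ne_top)
    refine h1.congr fun i => ENNReal.toReal_ofReal (ha i)
  rw [← ENNReal.ofReal_tsum_of_nonneg ha hs,
    ENNReal.ofReal_eq_ofReal_iff (tsum_nonneg ha) hb] at h
  exact h ▸ hs.hasSum

lemma tsum_ofReal_eq_of_hasSum {ι : Type*} {a : ι → ℝ} {b : ℝ} (ha : ∀ i, 0 ≤ a i)
    (h : HasSum a b) : ∑' i, ENNReal.ofReal (a i) = ENNReal.ofReal b := by
  rw [← ENNReal.ofReal_tsum_of_nonneg ha h.summable, h.tsum_eq]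

lemma tsum_enorm_sq_eq_of_hasSum {ι E F : Type*} [SeminormedAddGroup E] [SeminormedAddGroup F]
    {a : ι → E} {b : F} (h : HasSum (fun i => ‖a i‖ ^ 2) (‖b‖ ^ 2)) :
    ∑' i, ‖a i‖ₑ ^ 2 = ‖b‖ₑ ^ 2 := by
  simp_rw [enorm_sq_eq_ofReal]
  exact tsum_ofReal_eq_of_hasSum (fun i => by positivity) h

lemma lp_hasSum_norm_sq {ι : Type*} {E : ι → Type*} [∀ i, NormedAddCommGroup (E i)]
    (a : lp E 2) : HasSum (fun i => ‖a i‖ ^ 2) (‖a‖ ^ 2) := by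
  simpa using lp.hasSum_norm (p := 2) (by norm_num) a

lemma HilbertBasis.tsum_enorm_inner_sq {ι E : Type*} [NormedAddCommGroup E]
    [InnerProductSpace ℂ E] (b : HilbertBasis ι ℂ E) (x : E) :
    ∑' i, ‖inner ℂ (b i) x‖ₑ ^ 2 = ‖x‖ₑ ^ 2 := by
  refine tsum_enorm_sq_eq_of_hasSum ?_
  have h := lp_hasSum_norm_sq (b.repr x)
  simp only [HilbertBasis.repr_apply_apply, LinearIsometryEquiv.norm_map] at h
  exact h

lemma inner_starProjection_self_eq {E : Type*} [NormedAddCommGroup E] [InnerProductSpace ℂ E]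
    (U : Submodule ℂ E) [U.HasOrthogonalProjection] (x : E) :
    inner ℂ x (U.starProjection x) = ((‖U.starProjection x‖ ^ 2 : ℝ) : ℂ) := by
  have h : inner ℂ (x - U.starProjection x) (U.starProjection x) = 0 :=
    Submodule.starProjection_inner_eq_zero x _ (Submodule.starProjection_apply_mem _ _)
  rw [inner_sub_left, sub_eq_zero] at h
  rw [h, inner_self_eq_norm_sq_to_K]
  norm_cast

lemma inner_starProjection_of_mem {E : Type*} [NormedAddCommGroup E] [InnerProductSpace ℂ E]
    (U : Submodule ℂ E) [U.HasOrthogonalProjection] {w : E} (hw : w ∈ U) (x : E) :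
    inner ℂ w (U.starProjection x) = inner ℂ w x := by
  rw [← Submodule.inner_starProjection_left_eq_right, Submodule.starProjection_eq_self_iff.mpr hw]

end NormSums

namespace LocalFieldSetting

/-! ### Fiberwise projections and the integral characterization of σ_V -/

section Spectral

variable {K : Type*} [NontriviallyNormedField K] [IsUltrametricDist K] [ProperSpace K]
  [MeasurableSpace K] [BorelSpace K] {p : ℕ} [Fact p.Prime] [CharP K p]
  (S : LocalFieldSetting K p) {μ : Measure K} [μ.IsAddHaarMeasure]

/-- J(ξ) is built from one dense sequence; any other f ∈ V is a limit of its members with fibers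
converging almost everywhere, and J(ξ) is closed. -/
lemma fiber_mem_rangeFunction (hμ : μ (Metric.closedBall 0 1) = 1)
    {V : Submodule ℂ (Lp ℂ 2 μ)} {f : Lp ℂ 2 μ} (hf : f ∈ V) :
    ∀ᵐ ξ ∂μ, S.fiber f ξ ∈ S.rangeFunction V ξ := by
  have hmem : f ∈ closure (Set.range fun n => (TopologicalSpace.denseSeq V n : Lp ℂ 2 μ)) := by
    have h1 := TopologicalSpace.denseRange_denseSeq V
    have h2 := image_closure_subset_closure_image (s := Set.range (TopologicalSpace.denseSeq V))
      (continuous_subtype_val (p := fun f : Lp ℂ 2 μ => f ∈ V))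
    rw [h1.closure_range, ← Set.range_comp] at h2
    exact h2 ⟨⟨f, hf⟩, trivial, rfl⟩
  obtain ⟨g, hg, hlim⟩ := S.exists_seq_tendsto_fiber hμ hmem
  filter_upwards [hlim] with ξ hξ
  refine (Submodule.isClosed_topologicalClosure _).mem_of_tendsto hξ
    (Filter.Eventually.of_forall fun n => ?_)
  obtain ⟨m, hm⟩ := hg n
  rw [← hm]
  exact Submodule.le_topologicalClosure _ (Submodule.subset_span ⟨m, rfl⟩)

lemma T_mem {V : Submodule ℂ (Lp ℂ 2 μ)} (hV : IsTI μ S.lattice V) (k : ℕ) {f : Lp ℂ 2 μ}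
    (hf : f ∈ V) : S.T μ k f ∈ V := hV.2 _ ⟨k, rfl⟩ f hf

/-- Translation invariance enters here: g is orthogonal to every T_k f with f ∈ V, not only to f,
and this gives orthogonality in almost every fiber. -/
lemma fiber_mem_orthogonal_rangeFunction (hμ : μ (Metric.closedBall 0 1) = 1)
    {V : Submodule ℂ (Lp ℂ 2 μ)} (hV : IsTI μ S.lattice V) {g : Lp ℂ 2 μ} (hg : g ∈ Vᗮ) :
    ∀ᵐ ξ ∂μ, S.fiber g ξ ∈ (S.rangeFunction V ξ)ᗮ := by
  have h : ∀ᵐ ξ ∂μ, ∀ n, inner ℂ (S.fiber (TopologicalSpace.denseSeq V n : Lp ℂ 2 μ) ξ)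
      (S.fiber g ξ) = 0 := ae_all_iff.mpr fun n => S.inner_fiber_eq_zero hμ fun k =>
    (Submodule.mem_orthogonal _ _).mp hg _ (S.T_mem hV k (TopologicalSpace.denseSeq V n).2)
  filter_upwards [h] with ξ hξ
  rw [rangeFunction, Submodule.orthogonal_closure, Submodule.mem_orthogonal]
  intro v hv
  induction hv using Submodule.span_induction with
  | mem v hv =>
    obtain ⟨n, rfl⟩ := hv
    exact hξ n
  | zero => simp
  | add v w _ _ h1 h2 => rw [inner_add_left, h1, h2, add_zero]
  | smul r v _ h1 => exact (inner_smul_left v (S.fiber g ξ) r).trans (by rw [h1, mul_zero])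

/-- The fibers of the projection onto `V` are the projections of the fibers. -/
lemma fiber_starProjection (hμ : μ (Metric.closedBall 0 1) = 1)
    {V : Submodule ℂ (Lp ℂ 2 μ)} [V.HasOrthogonalProjection] (hV : IsTI μ S.lattice V)
    (f : Lp ℂ 2 μ) :
    ∀ᵐ ξ ∂μ, S.fiber (V.starProjection f) ξ =
      (S.rangeFunction V ξ).starProjection (S.fiber f ξ) := by
  filter_upwards [S.fiber_mem_rangeFunction hμ (Submodule.starProjection_apply_mem V f),
    S.fiber_mem_orthogonal_rangeFunction hμ hV (Submodule.sub_starProjection_mem_orthogonal f),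
    S.fiber_sub f (V.starProjection f)] with ξ h1 h2 h3
  rw [h3] at h2
  exact (Submodule.eq_starProjection_of_mem_orthogonal h1 h2).symm

lemma spectral_of_mem_cell (V : Submodule ℂ (Lp ℂ 2 μ)) {k : ℕ} {x : K} (hx : x ∈ S.cell k) :
    S.spectral V x =
      ‖(S.rangeFunction V (x - S.u k)).starProjection (lp.single 2 k (1 : ℂ))‖ ^ 2 := by
  have h : ∃ k : ℕ, ‖x - S.u k‖ ≤ 1 := ⟨k, S.mem_cell.mp hx⟩
  have key : ∀ n, n = k →
      ‖(S.rangeFunction V (x - S.u n)).starProjection (lp.single 2 n (1 : ℂ))‖ ^ 2 =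
        ‖(S.rangeFunction V (x - S.u k)).starProjection (lp.single 2 k (1 : ℂ))‖ ^ 2 := by
    rintro _ rfl
    rfl
  rw [spectral, dif_pos h]
  refine key _ (S.eq_of_mem_cell (S.mem_cell.mpr ?_) hx)
  generalize_proofs
  exact Nat.find_spec h

lemma spectral_nonneg (V : Submodule ℂ (Lp ℂ 2 μ)) (x : K) : 0 ≤ S.spectral V x := by
  obtain ⟨k, hk⟩ := S.exists_norm_sub_u_le x
  rw [S.spectral_of_mem_cell V (S.mem_cell.mpr hk)]
  positivity

lemma spectral_le_one (V : Submodule ℂ (Lp ℂ 2 μ)) (x : K) : S.spectral V x ≤ 1 := by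
  obtain ⟨k, hk⟩ := S.exists_norm_sub_u_le x
  rw [S.spectral_of_mem_cell V (S.mem_cell.mpr hk)]
  refine pow_le_one₀ (norm_nonneg _) ((Submodule.norm_starProjection_apply_le _ _).trans ?_)
  rw [lp.norm_single (by norm_num)]
  simp

lemma measure_ne_top_of_subset_cell {E : Set K} {j : ℕ} (hE : E ⊆ S.cell j) : μ E ≠ ∞ :=
  ((measure_mono hE).trans_lt (S.measure_cell_lt_top j)).ne

/-- The function whose Fourier transform is the indicator function of `E`. -/
noncomputable def band (hμ : μ (Metric.closedBall 0 1) = 1) {E : Set K} (hE : MeasurableSet E)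
    (hfin : μ E ≠ ∞) : Lp ℂ 2 μ :=
  (S.fourierEquiv hμ).symm (indicatorConstLp 2 hE hfin (1 : ℂ))

lemma fourier_band (hμ : μ (Metric.closedBall 0 1) = 1) {E : Set K} (hE : MeasurableSet E)
    (hfin : μ E ≠ ∞) : S.fourier μ (S.band hμ hE hfin) = indicatorConstLp 2 hE hfin (1 : ℂ) := by
  rw [S.fourier_eq hμ, band, LinearIsometryEquiv.apply_symm_apply]

lemma inner_band (hμ : μ (Metric.closedBall 0 1) = 1) {E : Set K} (hE : MeasurableSet E)
    (hfin : μ E ≠ ∞) (f : Lp ℂ 2 μ) :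
    inner ℂ (S.band hμ hE hfin) f = ∫ x in E, S.fourier μ f x ∂μ := by
  rw [← S.inner_fourier hμ, fourier_band, L2.inner_indicatorConstLp_one]

lemma ae_cell_of_ae_cell_zero {P : K → Prop} (j : ℕ)
    (h : ∀ᵐ ξ ∂μ.restrict (S.cell 0), P (ξ + S.u j)) : ∀ᵐ x ∂μ.restrict (S.cell j), P x := by
  rw [ae_restrict_iff' (S.measurableSet_cell _)] at h ⊢
  have h1 := (measurePreserving_sub_right μ (S.u j)).quasiMeasurePreserving.ae h
  filter_upwards [h1] with x hx hmem
  rw [sub_add_cancel] at hx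
  refine hx ?_
  rw [mem_cell] at hmem ⊢
  simpa using hmem

lemma add_u_mem_cell {ξ : K} (hξ : ξ ∈ S.cell 0) (k : ℕ) : ξ + S.u k ∈ S.cell k := by
  rw [mem_cell] at hξ ⊢
  simpa using hξ

/-- For ξ ∈ 𝒪 the point ξ + u(k) lies in the cell of u(k), so only the coordinate k = j can meet E.
-/
lemma fiber_band (hμ : μ (Metric.closedBall 0 1) = 1) {E : Set K} (hE : MeasurableSet E)
    {j : ℕ} (hj : E ⊆ S.cell j) :
    ∀ᵐ ξ ∂μ.restrict (S.cell 0),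
      S.fiber (S.band hμ hE (S.measure_ne_top_of_subset_cell hj)) ξ =
        E.indicator (fun _ => (1 : ℂ)) (ξ + S.u j) • lp.single 2 j (1 : ℂ) := by
  have hcoe := indicatorConstLp_coeFn (p := 2) (hs := hE)
    (hμs := S.measure_ne_top_of_subset_cell (μ := μ) hj) (c := (1 : ℂ))
  filter_upwards [ae_restrict_of_ae (S.fiber_apply (S.band hμ hE _)),
    ae_restrict_of_ae (S.ae_comp_add_u hcoe), ae_restrict_mem (S.measurableSet_cell 0)]
    with ξ h1 h2 h3
  ext k
  rw [h1, fourier_band, h2, lp.coeFn_smul, Pi.smul_apply, lp.coeFn_single, smul_eq_mul]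
  by_cases hk : k = j
  · subst hk
    simp
  · have : ξ + S.u k ∉ E := fun h => hk (S.eq_of_mem_cell (S.add_u_mem_cell h3 k) (hj h))
    simp [this, hk]

/-- On the Fourier side, the projection onto `V` of the function with transform `1_E` is the
spectral function on `E`, if `E` lies in one cell. -/
lemma fourier_starProjection_band (hμ : μ (Metric.closedBall 0 1) = 1)
    {V : Submodule ℂ (Lp ℂ 2 μ)} [V.HasOrthogonalProjection] (hV : IsTI μ S.lattice V)
    {E : Set K} (hE : MeasurableSet E) {j : ℕ} (hj : E ⊆ S.cell j) :
    ∀ᵐ x ∂μ.restrict (S.cell j),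
      S.fourier μ (V.starProjection (S.band hμ hE (S.measure_ne_top_of_subset_cell hj))) x =
        E.indicator (fun x => (S.spectral V x : ℂ)) x := by
  refine S.ae_cell_of_ae_cell_zero j ?_
  filter_upwards [S.fiber_band hμ hE hj, ae_restrict_of_ae (S.fiber_starProjection hμ hV _),
    ae_restrict_of_ae (S.fiber_apply (V.starProjection _)),
    ae_restrict_mem (S.measurableSet_cell 0)] with ξ h1 h2 h3 h4
  rw [← h3 j, h2, h1, map_smul]
  change E.indicator (fun _ => (1 : ℂ)) (ξ + S.u j) *
    ((S.rangeFunction V ξ).starProjection (lp.single 2 j (1 : ℂ))) j = _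
  have h5 := inner_starProjection_self_eq (S.rangeFunction V ξ) (lp.single 2 j (1 : ℂ))
  rw [lp.inner_single_left, RCLike.inner_apply, map_one, mul_one] at h5
  rw [h5]
  by_cases hx : ξ + S.u j ∈ E
  · rw [Set.indicator_of_mem hx, Set.indicator_of_mem hx,
      S.spectral_of_mem_cell V (S.add_u_mem_cell h4 j), one_mul, add_sub_cancel_right]
  · rw [Set.indicator_of_notMem hx, Set.indicator_of_notMem hx, zero_mul]

/-- No measurability of ξ ↦ J(ξ) is needed: on each cell σ_V agrees almost everywhere with the
Fourier transform of an element of L²(K). -/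
lemma aemeasurable_spectral (hμ : μ (Metric.closedBall 0 1) = 1)
    {V : Submodule ℂ (Lp ℂ 2 μ)} (hV : IsTI μ S.lattice V) :
    AEMeasurable (S.spectral V) μ := by
  have : CompleteSpace V := hV.1.completeSpace_coe
  suffices hres : AEMeasurable (S.spectral V) (μ.restrict (⋃ j, S.cell j)) by
    rwa [S.iUnion_cell, Measure.restrict_univ] at hres
  refine aemeasurable_iUnion_iff.mpr fun j => ?_
  have h := S.fourier_starProjection_band hμ hV (S.measurableSet_cell j) subset_rfl
  have hm := Complex.measurable_re.comp_aemeasurable ((Lp.aestronglyMeasurable (S.fourier μ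
    (V.starProjection (S.band hμ (S.measurableSet_cell j)
      (S.measure_cell_lt_top j).ne)))).aemeasurable.restrict (s := S.cell j))
  refine hm.congr ?_
  filter_upwards [h, ae_restrict_mem (S.measurableSet_cell j)] with x h1 h2
  rw [Function.comp_apply, h1, Set.indicator_of_mem h2, Complex.ofReal_re]

/-- The integral characterization of the spectral function. -/
lemma setLIntegral_spectral (hμ : μ (Metric.closedBall 0 1) = 1)
    {V : Submodule ℂ (Lp ℂ 2 μ)} [V.HasOrthogonalProjection] (hV : IsTI μ S.lattice V)
    {E : Set K} (hE : MeasurableSet E) {j : ℕ} (hj : E ⊆ S.cell j) :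
    ∫⁻ x in E, ENNReal.ofReal (S.spectral V x) ∂μ =
      ‖V.starProjection (S.band hμ hE (S.measure_ne_top_of_subset_cell hj))‖ₑ ^ 2 := by
  have hfin := S.measure_ne_top_of_subset_cell (μ := μ) hj
  have : IsFiniteMeasure (μ.restrict E) := isFiniteMeasure_restrict.mpr hfin
  have hint : Integrable (S.spectral V) (μ.restrict E) :=
    Integrable.of_bound (S.aemeasurable_spectral hμ hV).aestronglyMeasurable.restrict 1
      (ae_of_all _ fun x => by
        rw [Real.norm_of_nonneg (S.spectral_nonneg V x)]
        exact S.spectral_le_one V x)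
  rw [← ofReal_integral_eq_lintegral_ofReal hint (ae_of_all _ fun x => S.spectral_nonneg V x),
    enorm_sq_eq_ofReal]
  congr 1
  -- For g the `band` function of E, ⟨g, P_V g⟩ is ‖P_V g‖², and on the Fourier side it is the
  -- integral over E of the transform of P_V g, which is σ_V there.
  have h1 := inner_starProjection_self_eq V (S.band hμ hE hfin)
  rw [inner_band] at h1
  have h2 : ∫ x in E, S.fourier μ (V.starProjection (S.band hμ hE hfin)) x ∂μ =
      ∫ x in E, (S.spectral V x : ℂ) ∂μ := by
    refine integral_congr_ae ?_
    filter_upwards [ae_restrict_of_ae_restrict_of_subset hj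
      (S.fourier_starProjection_band hμ hV hE hj), ae_restrict_mem hE] with x h3 h4
    rw [h3, Set.indicator_of_mem h4]
  rw [h2, integral_complex_ofReal] at h1
  exact_mod_cast h1

lemma ae_eq_of_forall_setLIntegral_cell_eq {G H : K → ℝ≥0∞} (hG : AEMeasurable G μ)
    (hH : AEMeasurable H μ) (h : ∀ (j : ℕ) (E : Set K), MeasurableSet E → E ⊆ S.cell j →
      ∫⁻ x in E, G x ∂μ = ∫⁻ x in E, H x ∂μ) : G =ᵐ[μ] H := by
  refine S.ae_of_forall_ae_restrict_cell fun j => ?_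
  refine ae_eq_of_forall_setLIntegral_eq_of_sigmaFinite₀ hG.restrict hH.restrict fun E hE _ => ?_
  rw [Measure.restrict_restrict hE]
  exact h j _ (hE.inter (S.measurableSet_cell j)) Set.inter_subset_right

end Spectral

/-! ### Parseval generators -/

section Generators

variable {K : Type*} [NontriviallyNormedField K] [IsUltrametricDist K] [ProperSpace K]
  [MeasurableSpace K] [BorelSpace K] {p : ℕ} [Fact p.Prime] [CharP K p]
  (S : LocalFieldSetting K p) {μ : Measure K} [μ.IsAddHaarMeasure]

/-- Up to conjugation, the inner products are the Gabor coefficients of φ̂ 1_E in cell j, and those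
in the other cells vanish; this is Parseval's identity for φ̂ 1_E. -/
lemma tsum_enorm_inner_T_band (hμ : μ (Metric.closedBall 0 1) = 1) (φ : Lp ℂ 2 μ) {E : Set K}
    (hE : MeasurableSet E) {j : ℕ} (hj : E ⊆ S.cell j) :
    ∑' k, ‖inner ℂ (S.T μ k φ) (S.band hμ hE (S.measure_ne_top_of_subset_cell hj))‖ₑ ^ 2 =
      ∫⁻ x in E, ‖S.fourier μ φ x‖ₑ ^ 2 ∂μ := by
  set w : Lp ℂ 2 μ := ((Lp.memLp (S.fourier μ φ)).indicator hE).toLp _ with hw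
  have hwc : w =ᵐ[μ] E.indicator (S.fourier μ φ) := MemLp.coeFn_toLp _
  have hnorm : ‖w‖ₑ ^ 2 = ∫⁻ x in E, ‖S.fourier μ φ x‖ₑ ^ 2 ∂μ := by
    rw [enorm_sq_eq_lintegral, ← lintegral_indicator hE]
    refine lintegral_congr_ae ?_
    filter_upwards [hwc] with x hx
    rw [hx]
    by_cases h : x ∈ E <;> simp [h]
  have hinner : ∀ k l, inner ℂ (S.gabor μ (k, l)) w =
      ∫ x in S.cell l ∩ E, S.char (-S.u k) x * S.fourier μ φ x ∂μ := fun k l => by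
    rw [inner_gabor, Set.inter_comm, ← Measure.restrict_restrict hE, ← integral_indicator hE]
    refine integral_congr_ae (ae_restrict_of_ae ?_)
    filter_upwards [hwc] with x hx
    rw [hx]
    by_cases h : x ∈ E <;> simp [h]
  have hT : ∀ k, ‖inner ℂ (S.T μ k φ) (S.band hμ hE (S.measure_ne_top_of_subset_cell hj))‖ₑ =
      ‖inner ℂ (S.gabor μ (k, j)) w‖ₑ := fun k => by
    rw [hinner, Set.inter_eq_right.mpr hj, ← ofReal_norm, ← inner_conj_symm, RCLike.norm_conj,
      ofReal_norm, inner_band, T, S.fourier_translate hμ]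
    congr 1
    refine integral_congr_ae (ae_restrict_of_ae ?_)
    filter_upwards [S.coeFn_modulate (-S.u k) (S.fourier μ φ)] with x hx using hx
  have hzero : ∀ k l, l ≠ j → inner ℂ (S.gabor μ (k, l)) w = 0 := fun k l hl => by
    have hempty : S.cell l ∩ E = ∅ := by
      ext x
      simp only [Set.mem_inter_iff, Set.mem_empty_iff_false, iff_false, not_and]
      exact fun h1 h2 => hl (S.eq_of_mem_cell h1 (hj h2))
    rw [hinner, hempty, Measure.restrict_empty, integral_zero_measure]
  rw [← hnorm, ← (S.gaborBasis hμ).tsum_enorm_inner_sq w, ENNReal.tsum_prod']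
  refine tsum_congr fun k => ?_
  rw [hT, tsum_eq_single j fun l hl => by rw [coe_gaborBasis, hzero k l hl]; simp, coe_gaborBasis]

/-- For g the `band` function of E, ∫_E σ_V = ‖P_V g‖² is expanded in the frame. Since T_k φ_n ∈ V,
the projection may be dropped from the coefficients, and the sum over k gives ∫_E |φ̂_n|². -/
lemma ae_hasSum_of_parsevalFrame (hμ : μ (Metric.closedBall 0 1) = 1)
    {V : Submodule ℂ (Lp ℂ 2 μ)} (hV : IsTI μ S.lattice V) {ι : Type*} [Countable ι]
    (φ : ι → Lp ℂ 2 μ) (hφ : IsParsevalFrame V (fun i : ℕ × ι => S.T μ i.1 (φ i.2))) :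
    ∀ᵐ ξ ∂μ, HasSum (fun n => ‖S.fourier μ (φ n) ξ‖ ^ 2) (S.spectral V ξ) := by
  have : CompleteSpace V := hV.1.completeSpace_coe
  have hm : ∀ n, AEMeasurable (fun x => ‖S.fourier μ (φ n) x‖ₑ ^ 2) μ := fun n =>
    (Lp.aestronglyMeasurable _).enorm.pow_const 2
  have hsum : AEMeasurable (fun x => ∑' n, ‖S.fourier μ (φ n) x‖ₑ ^ 2) μ := AEMeasurable.tsum hm
  have key := S.ae_eq_of_forall_setLIntegral_cell_eq hsum
    (S.aemeasurable_spectral hμ hV).ennreal_ofReal fun j E hE hj => ?_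
  · filter_upwards [key] with ξ hξ
    refine hasSum_of_tsum_ofReal_eq (fun n => by positivity) (S.spectral_nonneg V ξ) ?_
    simpa only [enorm_sq_eq_ofReal] using hξ
  · rw [S.setLIntegral_spectral hμ hV hE hj, lintegral_tsum fun n => (hm n).restrict,
      ← tsum_enorm_sq_eq_of_hasSum (hφ.2 _ (Submodule.starProjection_apply_mem V _)),
      ENNReal.tsum_prod', ENNReal.tsum_comm]
    refine tsum_congr fun n => ?_
    rw [← S.tsum_enorm_inner_T_band hμ (φ n) hE hj]
    exact tsum_congr fun k => by rw [inner_starProjection_of_mem V (hφ.1 (k, n))]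

end Generators

end LocalFieldSetting

/-! ### Pythagoras for orthogonal sums, and the trace of a projection -/

section HilbertSums

variable {E : Type*} [NormedAddCommGroup E] [InnerProductSpace ℂ E] [CompleteSpace E]

/-- Pythagoras' theorem for the projections onto the summands of an orthogonal sum. -/
lemma tsum_enorm_starProjection_sq {ι : Type*} {V : Submodule ℂ E} {W : ι → Submodule ℂ E}
    [V.HasOrthogonalProjection] [∀ i, CompleteSpace (W i)]
    (hW : Pairwise fun i j => W i ⟂ W j) (hV : V = (⨆ i, W i).topologicalClosure) (x : E) :
    ∑' i, ‖(W i).starProjection x‖ₑ ^ 2 = ‖V.starProjection x‖ₑ ^ 2 := by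
  classical
  have hfam : OrthogonalFamily ℂ (fun i => W i) fun i => (W i).subtypeₗᵢ :=
    OrthogonalFamily.of_pairwise hW
  -- The ℓ² sum of the W i embeds isometrically with range V, so the norm of the projection can be
  -- read off from its components there.
  have hrange : V.starProjection x ∈ LinearMap.range hfam.linearIsometry.toLinearMap := by
    rw [hfam.range_linearIsometry]
    simp only [Submodule.subtypeₗᵢ_toLinearMap, Submodule.range_subtype]
    rw [← hV]
    exact Submodule.starProjection_apply_mem V x
  obtain ⟨a, ha⟩ := hrange
  change hfam.linearIsometry a = _ at ha
  have hle : ∀ i, W i ≤ V := fun i => by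
    rw [hV]
    exact (le_iSup W i).trans (Submodule.le_topologicalClosure _)
  have hproj : ∀ i, (W i).starProjection x = a i := fun i => by
    refine Submodule.eq_starProjection_of_mem_of_inner_eq_zero (a i).2 fun w hw => ?_
    rw [inner_sub_left, sub_eq_zero, ← inner_conj_symm, ← inner_conj_symm (a i : E) w]
    congr 1
    rw [← inner_starProjection_of_mem V (hle i hw), ← ha]
    have h1 := hfam.linearIsometry_apply_single (i := i) (⟨w, hw⟩ : W i)
    change _ = w at h1
    conv_lhs => rw [← h1]
    rw [LinearIsometry.inner_map_map, lp.inner_single_left]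
    rfl
  simp_rw [hproj]
  rw [← ha, ← ofReal_norm (hfam.linearIsometry a), LinearIsometry.norm_map, ofReal_norm]
  exact tsum_enorm_sq_eq_of_hasSum (lp_hasSum_norm_sq a)

lemma enorm_coe_submodule {J : Submodule ℂ E} (x : J) : ‖(x : E)‖ₑ = ‖x‖ₑ := by
  rw [← ofReal_norm, ← ofReal_norm, Submodule.coe_norm]

/-- The trace of an orthogonal projection is the dimension of its range. -/
lemma tsum_enorm_starProjection_sq_eq_rank {ι : Type*} (b : HilbertBasis ι ℂ E)
    (J : Submodule ℂ E) [CompleteSpace J] :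
    ∑' k, ‖J.starProjection (b k)‖ₑ ^ 2 = ((Cardinal.toENat (Module.rank ℂ J) : ℕ∞) : ℝ≥0∞) := by
  obtain ⟨w, c, -⟩ := exists_hilbertBasis ℂ J
  have h1 : ∀ k, ‖J.starProjection (b k)‖ₑ ^ 2 = ∑' i, ‖inner ℂ (b k) (c i : E)‖ₑ ^ 2 := fun k => by
    rw [Submodule.starProjection_apply, enorm_coe_submodule, ← c.tsum_enorm_inner_sq]
    refine tsum_congr fun i => ?_
    rw [Submodule.inner_orthogonalProjectionOnto_eq_of_mem_left, ← ofReal_norm, ← inner_conj_symm,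
      RCLike.norm_conj, ofReal_norm]
  have h2 : ∀ i, ∑' k, ‖inner ℂ (b k) (c i : E)‖ₑ ^ 2 = 1 := fun i => by
    rw [b.tsum_enorm_inner_sq, enorm_coe_submodule, ← ofReal_norm, c.orthonormal.1]
    simp
  simp_rw [h1]
  -- After the exchange each inner sum is ‖c i‖² = 1, so the double sum counts the basis c of J.
  rw [ENNReal.tsum_comm]
  simp_rw [h2]
  rw [ENNReal.tsum_set_one]
  congr 1
  rcases w.finite_or_infinite with hw | hw
  · have : Fintype w := hw.fintype
    have hdim := rank_eq_card_basis c.toOrthonormalBasis.toBasis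
    rw [hdim, Cardinal.toENat_nat, Set.encard_eq_coe_toFinset_card, Set.toFinset_card]
  -- An infinite Hilbert basis is not an algebraic basis, but its independence makes the rank
  -- infinite, and `toENat` identifies all infinite cardinals.
  · have : Infinite w := hw.to_subtype
    rw [hw.encard_eq, eq_comm, Cardinal.toENat_eq_top]
    exact (Cardinal.aleph0_le_mk w).trans c.orthonormal.linearIndependent.cardinal_le_rank

end HilbertSums

namespace LocalFieldSetting

/-! ### Additivity of σ and decomposition into principal spaces -/

section Additivity

variable {K : Type*} [NontriviallyNormedField K] [IsUltrametricDist K] [ProperSpace K]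
  [MeasurableSpace K] [BorelSpace K] {p : ℕ} [Fact p.Prime] [CharP K p]
  (S : LocalFieldSetting K p) {μ : Measure K} [μ.IsAddHaarMeasure]

/-- The spectral function is additive on countable orthogonal sums. -/
lemma ae_hasSum_spectral (hμ : μ (Metric.closedBall 0 1) = 1) {ι : Type*} [Countable ι]
    {V : Submodule ℂ (Lp ℂ 2 μ)} {W : ι → Submodule ℂ (Lp ℂ 2 μ)} (hV : IsTI μ S.lattice V)
    (hW : ∀ n, IsTI μ S.lattice (W n)) (hsum : IsOrthogonalSum V W) :
    ∀ᵐ ξ ∂μ, HasSum (fun n => S.spectral (W n) ξ) (S.spectral V ξ) := by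
  have : CompleteSpace V := hV.1.completeSpace_coe
  have : ∀ n, CompleteSpace (W n) := fun n => (hW n).1.completeSpace_coe
  have hm : ∀ n, AEMeasurable (fun x => ENNReal.ofReal (S.spectral (W n) x)) μ := fun n =>
    (S.aemeasurable_spectral hμ (hW n)).ennreal_ofReal
  have hms : AEMeasurable (fun x => ∑' n, ENNReal.ofReal (S.spectral (W n) x)) μ :=
    AEMeasurable.tsum hm
  have key := S.ae_eq_of_forall_setLIntegral_cell_eq hms
    (S.aemeasurable_spectral hμ hV).ennreal_ofReal fun j E hE hj => ?_
  · filter_upwards [key] with ξ hξ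
    exact hasSum_of_tsum_ofReal_eq (fun n => S.spectral_nonneg _ ξ) (S.spectral_nonneg V ξ) hξ
  -- Integrated over E, additivity is Pythagoras' theorem for the projections of the `band` function
  -- of E.
  · rw [S.setLIntegral_spectral hμ hV hE hj, lintegral_tsum fun n => (hm n).restrict,
      ← tsum_enorm_starProjection_sq hsum.1 hsum.2]
    exact tsum_congr fun n => S.setLIntegral_spectral hμ (hW n) hE hj

lemma translate_translate (a b : K) (f : Lp ℂ 2 μ) :
    translate μ a (translate μ b f) = translate μ (a + b) f := by
  refine Lp.ext ?_
  have h := (measurePreserving_sub_right μ a).quasiMeasurePreserving.ae (coeFn_translate b f)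
  filter_upwards [coeFn_translate a (translate μ b f), coeFn_translate (a + b) f, h]
    with x h1 h2 h3
  rw [h1, h2, h3, sub_sub]

lemma T_T (j k : ℕ) (f : Lp ℂ 2 μ) : S.T μ j (S.T μ k f) = S.T μ (S.shift j k) f := by
  rw [T, T, T, translate_translate, u_shift]

lemma T_zero (f : Lp ℂ 2 μ) : S.T μ 0 f = f := by
  refine Lp.ext ?_
  filter_upwards [coeFn_translate (S.u 0) f] with x hx
  rw [T, hx, u_zero, sub_zero]

lemma T_negEquiv_T (k : ℕ) (f : Lp ℂ 2 μ) : S.T μ (S.negEquiv k) (S.T μ k f) = f := by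
  have h : S.shift (S.negEquiv k) k = 0 := S.u_injective (by simp [u_shift, u_negEquiv])
  rw [T_T, h, T_zero]

lemma isTI_topologicalClosure {M : Submodule ℂ (Lp ℂ 2 μ)}
    (hM : ∀ k, ∀ f ∈ M, S.T μ k f ∈ M) : IsTI μ S.lattice M.topologicalClosure := by
  refine ⟨M.isClosed_topologicalClosure, ?_⟩
  rintro - ⟨k, rfl⟩ f hf
  exact map_mem_closure (S.T μ k).continuous hf fun g hg => hM k g hg

lemma T_mem_span {A : Set (Lp ℂ 2 μ)} (hA : ∀ k, ∀ f ∈ A, S.T μ k f ∈ A) (k : ℕ) :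
    ∀ f ∈ Submodule.span ℂ A, S.T μ k f ∈ Submodule.span ℂ A := by
  have h : Submodule.span ℂ A ≤ (Submodule.span ℂ A).comap (S.T μ k).toLinearMap :=
    Submodule.span_le.mpr fun f hf => Submodule.subset_span (hA k f hf)
  exact fun f hf => h hf

lemma isTI_principal (φ : Lp ℂ 2 μ) : IsTI μ S.lattice (S.principal μ φ) := by
  refine S.isTI_topologicalClosure (S.T_mem_span ?_)
  rintro k - ⟨l, rfl⟩
  exact ⟨S.shift k l, (S.T_T k l φ).symm⟩

lemma mem_principal (φ : Lp ℂ 2 μ) : φ ∈ S.principal μ φ :=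
  Submodule.le_topologicalClosure _ (Submodule.subset_span ⟨0, S.T_zero φ⟩)

lemma principal_le {V : Submodule ℂ (Lp ℂ 2 μ)} (hV : IsTI μ S.lattice V) {φ : Lp ℂ 2 μ}
    (hφ : φ ∈ V) : S.principal μ φ ≤ V := by
  refine Submodule.topologicalClosure_minimal _ (Submodule.span_le.mpr ?_) hV.1
  rintro - ⟨k, rfl⟩
  exact S.T_mem hV k hφ

/-- As 𝒵 is a group, the adjoint of T_k is again a lattice translation, and it preserves V. -/
lemma isTI_orthogonal {V : Submodule ℂ (Lp ℂ 2 μ)} (hV : IsTI μ S.lattice V) :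
    IsTI μ S.lattice Vᗮ := by
  refine ⟨Submodule.isClosed_orthogonal V, ?_⟩
  rintro - ⟨k, rfl⟩ g hg
  refine (Submodule.mem_orthogonal _ _).mpr fun f hf => ?_
  have h := (Submodule.mem_orthogonal _ _).mp hg _ (S.T_mem hV (S.negEquiv k) hf)
  rw [← S.T_negEquiv_T k g, LinearIsometry.inner_map_map] at h
  exact h

lemma isTI_closure_iSup {ι : Type*} {W : ι → Submodule ℂ (Lp ℂ 2 μ)}
    (hW : ∀ n, IsTI μ S.lattice (W n)) : IsTI μ S.lattice (⨆ n, W n).topologicalClosure := by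
  refine S.isTI_topologicalClosure fun k => ?_
  have h : (⨆ n, W n) ≤ (⨆ n, W n).comap (S.T μ k).toLinearMap :=
    iSup_le fun n f hf => (le_iSup W n) (S.T_mem (hW n) k hf)
  exact fun f hf => h hf

/-- Every translation invariant space is an orthogonal sum of a sequence of principal spaces. -/
lemma exists_isOrthogonalSum_principal {V : Submodule ℂ (Lp ℂ 2 μ)} (hV : IsTI μ S.lattice V) :
    ∃ φ : ℕ → Lp ℂ 2 μ, IsOrthogonalSum V fun n => S.principal μ (φ n) := by
  set f : ℕ → Lp ℂ 2 μ := fun n => TopologicalSpace.denseSeq V n with hf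
  have hfV : ∀ n, f n ∈ V := fun n => (TopologicalSpace.denseSeq V n).2
  -- Gram–Schmidt with invariant subspaces: W n is generated by the first n members of a dense
  -- sequence, and φ n is the part of the next member orthogonal to W n.
  let W : ℕ → Submodule ℂ (Lp ℂ 2 μ) := fun n =>
    (⨆ m : Fin n, S.principal μ (f m)).topologicalClosure
  have hW : ∀ n, IsTI μ S.lattice (W n) := fun n => S.isTI_closure_iSup fun m => S.isTI_principal _
  have : ∀ n, CompleteSpace (W n) := fun n => (hW n).1.completeSpace_coe
  have hfW : ∀ {m n}, m < n → f m ∈ W n := fun {m n} hmn =>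
    Submodule.le_topologicalClosure _
      (le_iSup (fun m : Fin n => S.principal μ (f m)) ⟨m, hmn⟩ (S.mem_principal (f m)))
  have hWle : ∀ {n} {U : Submodule ℂ (Lp ℂ 2 μ)}, IsTI μ S.lattice U → (∀ m < n, f m ∈ U) →
      W n ≤ U := fun {n U} hU h =>
    Submodule.topologicalClosure_minimal _ (iSup_le fun m => S.principal_le hU (h m m.2)) hU.1
  let φ : ℕ → Lp ℂ 2 μ := fun n => f n - (W n).starProjection (f n)
  have hφ : ∀ n, f n = φ n + (W n).starProjection (f n) := fun n => (sub_add_cancel _ _).symm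
  have hφW : ∀ {m n}, m < n → S.principal μ (φ m) ≤ W n := fun {m n} hmn =>
    S.principal_le (hW n) (Submodule.sub_mem _ (hfW hmn)
      (hWle (hW n) (fun l hl => hfW (hl.trans hmn)) (Submodule.starProjection_apply_mem _ _)))
  have hφort : ∀ n, S.principal μ (φ n) ≤ (W n)ᗮ := fun n =>
    S.principal_le (S.isTI_orthogonal (hW n)) (Submodule.sub_starProjection_mem_orthogonal _)
  have hlt : ∀ {m n}, m < n → S.principal μ (φ m) ⟂ S.principal μ (φ n) := fun {m n} hmn =>
    (Submodule.isOrtho_orthogonal_right (W n)).mono (hφW hmn) (hφort n)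
  refine ⟨φ, fun m n hmn => ?_, le_antisymm ?_ ?_⟩
  · rcases lt_or_gt_of_ne hmn with h | h
    · exact hlt h
    · exact (hlt h).symm
  · set U := (⨆ n, S.principal μ (φ n)).topologicalClosure with hUdef
    have hU : IsTI μ S.lattice U := S.isTI_closure_iSup fun n => S.isTI_principal _
    have hφU : ∀ n, φ n ∈ U := fun n => Submodule.le_topologicalClosure _
      (le_iSup (fun n => S.principal μ (φ n)) n (S.mem_principal (φ n)))
    have hfU : ∀ n, f n ∈ U := fun n => by
      induction n using Nat.strong_induction_on with
      | _ n ih =>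
        rw [hφ n]
        exact Submodule.add_mem _ (hφU n)
          (hWle hU ih (Submodule.starProjection_apply_mem _ _))
    intro g hg
    have h1 := TopologicalSpace.denseRange_denseSeq V
    have h2 := image_closure_subset_closure_image (s := Set.range (TopologicalSpace.denseSeq V))
      (continuous_subtype_val (p := fun f : Lp ℂ 2 μ => f ∈ V))
    rw [h1.closure_range, ← Set.range_comp] at h2
    refine closure_minimal ?_ hU.1 (h2 ⟨⟨g, hg⟩, trivial, rfl⟩)
    rintro - ⟨n, rfl⟩
    exact hfU n
  · refine Submodule.topologicalClosure_minimal _ (iSup_le fun n => S.principal_le hV ?_) hV.1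
    exact Submodule.sub_mem _ (hfV n)
      (hWle hV (fun m _ => hfV m) (Submodule.starProjection_apply_mem _ _))

end Additivity

/-! ### The spectral function of a principal space -/

section Principal

variable {K : Type*} [NontriviallyNormedField K] [IsUltrametricDist K] [ProperSpace K]
  [MeasurableSpace K] [BorelSpace K] {p : ℕ} [Fact p.Prime] [CharP K p]
  (S : LocalFieldSetting K p) {μ : Measure K} [μ.IsAddHaarMeasure]

/-- Fibers of the T_k φ are multiples of the fiber of φ, and a span of one vector is closed under
limits. -/
lemma fiber_mem_span_of_mem_principal (hμ : μ (Metric.closedBall 0 1) = 1) {φ f : Lp ℂ 2 μ}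
    (hf : f ∈ S.principal μ φ) :
    ∀ᵐ ξ ∂μ, S.fiber f ξ ∈ Submodule.span ℂ {S.fiber φ ξ} := by
  obtain ⟨g, hg, hlim⟩ := S.exists_seq_tendsto_fiber hμ hf
  have hspan : ∀ h ∈ Submodule.span ℂ (Set.range fun k => S.T μ k φ),
      ∀ᵐ ξ ∂μ, S.fiber h ξ ∈ Submodule.span ℂ {S.fiber φ ξ} := fun h hh => by
    induction hh using Submodule.span_induction with
    | mem h hh =>
      obtain ⟨k, rfl⟩ := hh
      filter_upwards [S.fiber_T hμ k φ] with ξ hξ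
      rw [hξ]
      exact Submodule.smul_mem _ _ (Submodule.mem_span_singleton_self _)
    | zero =>
      filter_upwards [S.fiber_zero (μ := μ)] with ξ hξ
      rw [hξ]
      exact Submodule.zero_mem _
    | add h h' _ _ ih ih' =>
      filter_upwards [ih, ih', S.fiber_add h h'] with ξ h1 h2 h3
      rw [h3]
      exact Submodule.add_mem _ h1 h2
    | smul r h _ ih =>
      filter_upwards [ih, S.fiber_smul r h] with ξ h1 h2
      rw [h2]
      exact Submodule.smul_mem _ _ h1
  filter_upwards [hlim, ae_all_iff.mpr fun n => hspan (g n) (hg n)] with ξ h1 h2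
  exact (Submodule.closed_of_finiteDimensional _).mem_of_tendsto h1
    (Filter.Eventually.of_forall h2)

lemma rangeFunction_principal (hμ : μ (Metric.closedBall 0 1) = 1) (φ : Lp ℂ 2 μ) :
    ∀ᵐ ξ ∂μ, S.rangeFunction (S.principal μ φ) ξ = Submodule.span ℂ {S.fiber φ ξ} := by
  have h := ae_all_iff.mpr fun n => S.fiber_mem_span_of_mem_principal hμ
    (TopologicalSpace.denseSeq (S.principal μ φ) n).2
  filter_upwards [S.fiber_mem_rangeFunction hμ (S.mem_principal φ), h] with ξ h1 h2
  refine le_antisymm (Submodule.topologicalClosure_minimal _ (Submodule.span_le.mpr ?_)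
    (Submodule.closed_of_finiteDimensional _)) (by simpa using h1)
  rintro - ⟨n, rfl⟩
  exact h2 n

/-- The permutation of coordinates which is induced by translation by `u(j)`. -/
lemma fiber_add_u (f : Lp ℂ 2 μ) (ξ : K) (j k : ℕ) :
    S.fiber f (ξ + S.u j) k = S.fiber f ξ (S.shift j k) := by
  have hval : ∀ k, S.fourier μ f (ξ + S.u j + S.u k) = S.fourier μ f (ξ + S.u (S.shift j k)) :=
    fun k => by rw [u_shift, add_assoc]
  have hiff : Memℓp (fun k => S.fourier μ f (ξ + S.u j + S.u k)) 2 ↔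
      Memℓp (fun k => S.fourier μ f (ξ + S.u k)) 2 := by
    simp_rw [memℓp_two_iff, hval]
    rw [(S.shift j).tsum_eq (fun k => ‖S.fourier μ f (ξ + S.u k)‖ₑ ^ 2)]
  by_cases h : Memℓp (fun k => S.fourier μ f (ξ + S.u k)) 2
  · rw [fiber, fiber, dif_pos h, dif_pos (hiff.mpr h)]
    exact hval k
  · rw [fiber, fiber, dif_neg h, dif_neg (hiff.not.mpr h)]
    rfl

/-- For J(ξ) spanned by one vector a ≠ 0, the projection of e_j has squared norm |a_j|²/‖a‖², and
‖a‖² is the 𝒵-periodic sum in the denominator. -/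
lemma spectral_principal (hμ : μ (Metric.closedBall 0 1) = 1) (φ : Lp ℂ 2 μ) :
    ∀ᵐ ξ ∂μ, S.spectral (S.principal μ φ) ξ = S.principalSpectral φ ξ := by
  refine S.ae_of_forall_ae_restrict_cell fun j => S.ae_cell_of_ae_cell_zero j ?_
  filter_upwards [ae_restrict_of_ae (S.rangeFunction_principal hμ φ),
    ae_restrict_of_ae (S.fiber_apply φ), ae_restrict_mem (S.measurableSet_cell 0)] with ξ h1 h2 h3
  have hproj : (S.rangeFunction (S.principal μ φ) ξ).starProjection (lp.single 2 j (1 : ℂ)) =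
      (Submodule.span ℂ {S.fiber φ ξ}).starProjection (lp.single 2 j (1 : ℂ)) := by
    congr!
  have hnorm : ∑' k, ‖S.fourier μ φ (ξ + S.u j + S.u k)‖ ^ 2 = ‖S.fiber φ ξ‖ ^ 2 := by
    rw [← (lp_hasSum_norm_sq (S.fiber φ ξ)).tsum_eq,
      ← (S.shift j).tsum_eq (fun k => ‖S.fiber φ ξ k‖ ^ 2)]
    exact tsum_congr fun k => by rw [h2, u_shift, add_assoc]
  rw [S.spectral_of_mem_cell _ (S.add_u_mem_cell h3 j), add_sub_cancel_right, hproj,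
    Submodule.starProjection_singleton, lp.inner_single_right, principalSpectral, hnorm, ← h2 j,
    norm_smul, norm_div]
  simp only [RCLike.inner_apply, one_mul, RCLike.norm_conj]
  by_cases h0 : S.fiber φ ξ j = 0
  · simp [h0]
  · have hne : ‖S.fiber φ ξ‖ ≠ 0 := fun h => h0 (by rw [norm_eq_zero.mp h]; rfl)
    rw [if_pos h0]
    simp
    field_simp

end Principal

/-! ### The multiplicity function as a trace -/

section Multiplicity

/-- The canonical Hilbert basis of `ℓ²`. -/
noncomputable def standardBasis : HilbertBasis ℕ ℂ (lp (fun _ : ℕ => ℂ) 2) :=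
  HilbertBasis.ofRepr (LinearIsometryEquiv.refl ℂ _)

lemma standardBasis_apply (k : ℕ) : standardBasis k = lp.single 2 k (1 : ℂ) :=
  (standardBasis.repr_symm_single k).symm

lemma memℓp_comp_equiv (e : ℕ ≃ ℕ) {a : ℕ → ℂ} (ha : Memℓp a 2) :
    Memℓp (fun k => a (e k)) 2 := by
  rw [memℓp_two_iff] at ha ⊢
  rwa [e.tsum_eq (fun k => ‖a k‖ₑ ^ 2)]

/-- The unitary operator on `ℓ²` which permutes the coordinates by `e`. -/
noncomputable def permute (e : ℕ ≃ ℕ) :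
    lp (fun _ : ℕ => ℂ) 2 ≃ₗᵢ[ℂ] lp (fun _ : ℕ => ℂ) 2 where
  toFun a := ⟨fun k => a (e k), memℓp_comp_equiv e (lp.memℓp a)⟩
  invFun a := ⟨fun k => a (e.symm k), memℓp_comp_equiv e.symm (lp.memℓp a)⟩
  map_add' a b := rfl
  map_smul' r a := rfl
  left_inv a := by
    refine lp.ext (funext fun k => ?_)
    change a (e (e.symm k)) = a k
    rw [e.apply_symm_apply]
  right_inv a := by
    refine lp.ext (funext fun k => ?_)
    change a (e.symm (e k)) = a k
    rw [e.symm_apply_apply]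
  norm_map' a := by
    rw [← sq_eq_sq₀ (norm_nonneg _) (norm_nonneg _), ← (lp_hasSum_norm_sq a).tsum_eq,
      ← e.tsum_eq]
    exact (lp_hasSum_norm_sq _).tsum_eq.symm

variable {K : Type*} [NontriviallyNormedField K] [IsUltrametricDist K] [ProperSpace K]
  [MeasurableSpace K] [BorelSpace K] {p : ℕ} [Fact p.Prime] [CharP K p]
  (S : LocalFieldSetting K p) {μ : Measure K} [μ.IsAddHaarMeasure]

lemma fiber_add_u_eq_permute (f : Lp ℂ 2 μ) (ξ : K) (j : ℕ) :
    S.fiber f (ξ + S.u j) = permute (S.shift j) (S.fiber f ξ) :=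
  lp.ext (funext fun k => S.fiber_add_u f ξ j k)

/-- The same dense sequence is used at every point and a shift by u(j) permutes the coordinates of
each fiber, so this holds for every ξ, with no null set. -/
lemma rangeFunction_add_u (V : Submodule ℂ (Lp ℂ 2 μ)) (ξ : K) (j : ℕ) :
    S.rangeFunction V (ξ + S.u j) =
      (S.rangeFunction V ξ).map (permute (S.shift j)).toLinearEquiv.toLinearMap := by
  refine le_antisymm (Submodule.topologicalClosure_minimal _ (Submodule.span_le.mpr ?_) ?_) ?_
  · rintro - ⟨n, rfl⟩
    exact ⟨_, Submodule.le_topologicalClosure _ (Submodule.subset_span ⟨n, rfl⟩),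
      (S.fiber_add_u_eq_permute _ ξ j).symm⟩
  · exact (permute (S.shift j)).toHomeomorph.isClosedMap _
      (Submodule.isClosed_topologicalClosure _)
  · rw [Submodule.map_le_iff_le_comap]
    refine Submodule.topologicalClosure_minimal _ (Submodule.span_le.mpr ?_) ?_
    · rintro - ⟨n, rfl⟩
      refine Submodule.le_topologicalClosure _ (Submodule.subset_span ⟨n, ?_⟩)
      exact S.fiber_add_u_eq_permute _ ξ j
    · exact (Submodule.isClosed_topologicalClosure _).preimage (permute (S.shift j)).continuous

lemma multiplicity_add_u (V : Submodule ℂ (Lp ℂ 2 μ)) (ξ : K) (j : ℕ) :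
    S.multiplicity V (ξ + S.u j) = S.multiplicity V ξ := by
  rw [multiplicity, multiplicity, rangeFunction_add_u]
  congr 1
  exact ((permute (S.shift j)).toLinearEquiv.submoduleMap (S.rangeFunction V ξ)).rank_eq.symm

/-- With ξ moved into 𝒪, the values σ_V(ξ + u(k)) are, up to order, the ‖P e_k‖² for one projection
P, and their sum is its trace. -/
lemma multiplicity_eq_tsum (V : Submodule ℂ (Lp ℂ 2 μ)) (ξ : K) :
    ((S.multiplicity V ξ : ℕ∞) : ℝ≥0∞) =
      ∑' k : ℕ, ENNReal.ofReal (S.spectral V (ξ + S.u k)) := by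
  obtain ⟨j, hj⟩ := S.exists_norm_sub_u_le ξ
  have h0 : ξ - S.u j ∈ S.cell 0 := by simpa [mem_cell] using hj
  have h1 : ∀ k, ENNReal.ofReal (S.spectral V (ξ + S.u k)) =
      ‖(S.rangeFunction V (ξ - S.u j)).starProjection (standardBasis (S.shift j k))‖ₑ ^ 2 :=
    fun k => by
      have h2 : ξ + S.u k = ξ - S.u j + S.u (S.shift j k) := by rw [u_shift]; ring
      rw [h2, S.spectral_of_mem_cell V (S.add_u_mem_cell h0 _), add_sub_cancel_right,
        standardBasis_apply, enorm_sq_eq_ofReal]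
  simp_rw [h1]
  rw [(S.shift j).tsum_eq (fun k =>
    ‖(S.rangeFunction V (ξ - S.u j)).starProjection (standardBasis k)‖ₑ ^ 2),
    tsum_enorm_starProjection_sq_eq_rank, ← sub_add_cancel ξ (S.u j), multiplicity_add_u,
    add_sub_cancel_right]
  rfl

end Multiplicity

/-! ### Dilation by 𝔭 -/

section Dilation

variable {K : Type*} [NontriviallyNormedField K] [IsUltrametricDist K] [ProperSpace K]
  [MeasurableSpace K] [BorelSpace K] {p : ℕ} [Fact p.Prime] [CharP K p]
  (S : LocalFieldSetting K p) {μ : Measure K} [μ.IsAddHaarMeasure]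

variable (μ) in
/-- The change of variables `x ↦ a x`. -/
lemma exists_modulus {a : K} (ha : a ≠ 0) : ∃ m : ℝ, 0 < m ∧
    (∀ g : K → ℂ, ∫ x, g (a * x) ∂μ = m * ∫ x, g x ∂μ) ∧
    (∀ g : K → ℝ≥0∞, ∫⁻ x, g (a * x) ∂μ = ENNReal.ofReal m * ∫⁻ x, g x ∂μ) := by
  obtain ⟨c, hc, h⟩ := map_mul_left μ ha
  have hemb : MeasurableEmbedding (fun x => a * x) :=
    (Homeomorph.mulLeft₀ a ha).measurableEmbedding
  have hc0 : c ≠ 0 := by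
    rintro rfl
    rw [zero_smul, Measure.map_eq_zero_iff hemb.measurable.aemeasurable] at h
    exact NeZero.ne μ h
  refine ⟨c.toReal, ENNReal.toReal_pos hc0 hc, fun g => ?_, fun g => ?_⟩
  · rw [← hemb.integral_map, h, integral_smul_measure, Complex.real_smul]
  · rw [← hemb.lintegral_map, h, lintegral_smul_measure, ENNReal.ofReal_toReal hc, smul_eq_mul]

lemma coeFn_dilate (f : Lp ℂ 2 μ) :
    S.dilate μ f =ᵐ[μ] fun x => (Real.sqrt S.q : ℂ) * f (S.prime⁻¹ * x) := by
  have h1 := Lp.coeFn_smul (Real.sqrt S.q : ℂ)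
    ((memLp_comp_mul μ (inv_ne_zero S.prime_ne_zero) (Lp.memLp f)).toLp
      (fun x => f (S.prime⁻¹ * x)))
  have h2 := (memLp_comp_mul μ (inv_ne_zero S.prime_ne_zero) (Lp.memLp f)).coeFn_toLp
  filter_upwards [h1, h2] with x hx1 hx2
  exact hx1.trans (by rw [Pi.smul_apply, hx2, smul_eq_mul])

variable (μ) in
/-- The modulus of `𝔭⁻¹`. -/
noncomputable def modulus : ℝ := (exists_modulus μ (inv_ne_zero S.prime_ne_zero)).choose

variable (μ) in
lemma modulus_pos : 0 < S.modulus μ :=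
  (exists_modulus μ (inv_ne_zero S.prime_ne_zero)).choose_spec.1

lemma integral_comp_prime_inv_mul (g : K → ℂ) :
    ∫ x, g (S.prime⁻¹ * x) ∂μ = S.modulus μ * ∫ x, g x ∂μ :=
  (exists_modulus μ (inv_ne_zero S.prime_ne_zero)).choose_spec.2.1 g

lemma lintegral_comp_prime_inv_mul (g : K → ℝ≥0∞) :
    ∫⁻ x, g (S.prime⁻¹ * x) ∂μ = ENNReal.ofReal (S.modulus μ) * ∫⁻ x, g x ∂μ :=
  (exists_modulus μ (inv_ne_zero S.prime_ne_zero)).choose_spec.2.2 g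

lemma sqrt_q_mul_self : (Real.sqrt S.q : ℂ) * (Real.sqrt S.q : ℂ) = S.q := by
  rw [← Complex.ofReal_mul, Real.mul_self_sqrt (Nat.cast_nonneg _), Complex.ofReal_natCast]

/-- The factor is in fact 1, the modulus being 1/q, but only its positivity is used: a multiple of
an isometry already preserves closedness and orthogonality. -/
lemma inner_dilate (f g : Lp ℂ 2 μ) :
    inner ℂ (S.dilate μ f) (S.dilate μ g) = (S.q * S.modulus μ : ℂ) * inner ℂ f g := by
  rw [L2.inner_def, L2.inner_def, mul_assoc, ← S.integral_comp_prime_inv_mul (μ := μ),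
    ← integral_const_mul]
  refine integral_congr_ae ?_
  filter_upwards [S.coeFn_dilate f, S.coeFn_dilate g] with x h1 h2
  rw [h1, h2, RCLike.inner_apply, RCLike.inner_apply, map_mul, Complex.conj_ofReal,
    ← S.sqrt_q_mul_self]
  ring

lemma norm_dilate_sq (f : Lp ℂ 2 μ) : ‖S.dilate μ f‖ ^ 2 = S.q * S.modulus μ * ‖f‖ ^ 2 := by
  have h := S.inner_dilate f f
  rw [inner_self_eq_norm_sq_to_K, inner_self_eq_norm_sq_to_K] at h
  refine Complex.ofReal_injective ?_
  push_cast
  exact h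

lemma norm_dilate (f : Lp ℂ 2 μ) : ‖S.dilate μ f‖ = Real.sqrt (S.q * S.modulus μ) * ‖f‖ := by
  have hpos : 0 ≤ S.q * S.modulus μ := mul_nonneg (Nat.cast_nonneg _) (S.modulus_pos μ).le
  rw [← sq_eq_sq₀ (norm_nonneg _) (by positivity), norm_dilate_sq, mul_pow, Real.sq_sqrt hpos]

lemma sqrt_q_mul_modulus_pos : 0 < Real.sqrt (S.q * S.modulus μ) :=
  Real.sqrt_pos.mpr (mul_pos (Nat.cast_pos.mpr S.q_pos) (S.modulus_pos μ))

variable (μ) in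
/-- The dilation as a continuous linear map. -/
noncomputable def dilateL : Lp ℂ 2 μ →L[ℂ] Lp ℂ 2 μ :=
  (S.dilate μ).mkContinuous (Real.sqrt (S.q * S.modulus μ)) fun f => (S.norm_dilate f).le

lemma isClosedMap_dilate : IsClosedMap (S.dilate μ) := by
  have hanti : AntilipschitzWith (Real.sqrt (S.q * S.modulus μ)).toNNReal⁻¹ (S.dilate μ) :=
    AddMonoidHomClass.antilipschitz_of_bound (S.dilate μ) fun f => by
      rw [norm_dilate, NNReal.coe_inv, Real.coe_toNNReal _ (Real.sqrt_nonneg _),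
        inv_mul_cancel_left₀ S.sqrt_q_mul_modulus_pos.ne']
  exact (hanti.isClosedEmbedding (S.dilateL μ).uniformContinuous).isClosedMap

lemma dilate_injective : Function.Injective (S.dilate μ) := by
  refine (injective_iff_map_eq_zero _).mpr fun f hf => ?_
  have h := S.norm_dilate f
  rw [hf, norm_zero, eq_comm, mul_eq_zero] at h
  exact norm_eq_zero.mp (h.resolve_left S.sqrt_q_mul_modulus_pos.ne')

lemma translate_dilate (n : ℕ) (f : Lp ℂ 2 μ) :
    translate μ (S.prime * S.u n) (S.dilate μ f) = S.dilate μ (S.T μ n f) := by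
  refine Lp.ext ?_
  have h1 := (measurePreserving_sub_right μ (S.prime * S.u n)).quasiMeasurePreserving.ae
    (S.coeFn_dilate f)
  have h2 := ae_comp_mul μ (inv_ne_zero S.prime_ne_zero) (coeFn_translate (S.u n) f)
  filter_upwards [coeFn_translate (S.prime * S.u n) (S.dilate μ f), h1, h2,
    S.coeFn_dilate (S.T μ n f)] with x h3 h4 h5 h6
  rw [h3, h4, h6, T, h5, mul_sub, inv_mul_cancel_left₀ S.prime_ne_zero]

lemma isTI_dilatedLattice_map_dilate {V : Submodule ℂ (Lp ℂ 2 μ)} (hV : IsTI μ S.lattice V) :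
    IsTI μ S.dilatedLattice (V.map (S.dilate μ)) := by
  refine ⟨S.isClosedMap_dilate _ hV.1, ?_⟩
  rintro - ⟨n, rfl⟩ - ⟨f, hf, rfl⟩
  exact ⟨S.T μ n f, S.T_mem hV n hf, (S.translate_dilate n f).symm⟩

lemma lattice_subset_dilatedLattice : S.lattice ⊆ S.dilatedLattice := by
  rintro - ⟨n, rfl⟩
  refine ⟨S.q * n, ?_⟩
  change S.prime * S.u (S.q * n) = S.u n
  rw [u_q_mul, mul_inv_cancel_left₀ S.prime_ne_zero]

lemma isTI_map_dilate {V : Submodule ℂ (Lp ℂ 2 μ)} (hV : IsTI μ S.lattice V) :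
    IsTI μ S.lattice (V.map (S.dilate μ)) :=
  ⟨(S.isTI_dilatedLattice_map_dilate hV).1, fun a ha =>
    (S.isTI_dilatedLattice_map_dilate hV).2 a (S.lattice_subset_dilatedLattice ha)⟩

/-- The dilation intertwines the Fourier transform with a multiple of the inverse dilation. -/
lemma dilate_fourier_dilate (hμ : μ (Metric.closedBall 0 1) = 1) (f : Lp ℂ 2 μ) :
    S.dilate μ (S.fourier μ (S.dilate μ f)) = (S.q * S.modulus μ : ℂ) • S.fourier μ f := by
  have h : (S.dilateL μ).comp ((S.fourier μ).comp (S.dilateL μ)) =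
      (S.q * S.modulus μ : ℂ) • S.fourier μ := by
    refine S.ext_of_forall_integrable hμ fun f hf => Lp.ext ?_
    have hint : Integrable (S.dilate μ f) μ := by
      obtain ⟨c, hc, hmap⟩ := map_mul_left μ (inv_ne_zero S.prime_ne_zero)
      have h1 : Integrable f (Measure.map (fun x => S.prime⁻¹ * x) μ) := by
        rw [hmap]
        exact hf.smul_measure hc
      exact ((h1.comp_measurable (continuous_const_mul _).measurable).const_mul _).congr
        (S.coeFn_dilate f).symm
    have hF : ∀ᵐ ξ ∂μ, S.fourier μ (S.dilate μ f) ξ = (Real.sqrt S.q : ℂ) * (S.modulus μ *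
        Fourier.fourierIntegral S.chi μ f (S.prime * ξ)) := by
      filter_upwards [S.fourier_spec hμ _ hint] with ξ hξ
      rw [hξ, fourierIntegral_eq, fourierIntegral_eq, ← S.integral_comp_prime_inv_mul,
        ← integral_const_mul]
      refine integral_congr_ae ?_
      filter_upwards [S.coeFn_dilate f] with x hx
      have hchar : S.char (-(S.prime * ξ)) (S.prime⁻¹ * x) = S.char (-ξ) x := by
        rw [char, char]
        congr 2
        have := S.prime_ne_zero
        field_simp
      rw [hx, hchar]
      ring
    filter_upwards [S.coeFn_dilate (S.fourier μ (S.dilate μ f)),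
      ae_comp_mul μ (inv_ne_zero S.prime_ne_zero) hF, S.fourier_spec hμ f hf,
      Lp.coeFn_smul (S.q * S.modulus μ : ℂ) (S.fourier μ f)] with ξ h1 h2 h3 h4
    change S.dilate μ (S.fourier μ (S.dilate μ f)) ξ = ((S.q * S.modulus μ : ℂ) • S.fourier μ f) ξ
    rw [h1, h2, h4, Pi.smul_apply, h3, mul_inv_cancel_left₀ S.prime_ne_zero, smul_eq_mul,
      ← S.sqrt_q_mul_self]
    ring
  exact congrArg (fun A => A f) h

lemma starProjection_map_dilate {V : Submodule ℂ (Lp ℂ 2 μ)} [V.HasOrthogonalProjection]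
    [(V.map (S.dilate μ)).HasOrthogonalProjection] (f : Lp ℂ 2 μ) :
    (V.map (S.dilate μ)).starProjection (S.dilate μ f) = S.dilate μ (V.starProjection f) := by
  refine Submodule.eq_starProjection_of_mem_of_inner_eq_zero
    ⟨_, Submodule.starProjection_apply_mem V f, rfl⟩ ?_
  rintro - ⟨w, hw, rfl⟩
  rw [← map_sub, inner_dilate, Submodule.starProjection_inner_eq_zero f w hw, mul_zero]

/-- The preimage is 𝔭E. The identity is checked after the Fourier transform and one more dilation,
both injective, where both sides are multiples of its indicator. -/
lemma dilate_band (hμ : μ (Metric.closedBall 0 1) = 1) {E : Set K} (hE : MeasurableSet E)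
    (hfin : μ E ≠ ∞) (hE' : MeasurableSet ((fun x => S.prime⁻¹ * x) ⁻¹' E))
    (hfin' : μ ((fun x => S.prime⁻¹ * x) ⁻¹' E) ≠ ∞) :
    S.dilate μ (S.band hμ hE' hfin') =
      ((Real.sqrt S.q : ℂ) * S.modulus μ) • S.band hμ hE hfin := by
  apply (S.fourierEquiv hμ).injective
  rw [← S.fourier_eq hμ, ← S.fourier_eq hμ]
  apply S.dilate_injective
  rw [S.dilate_fourier_dilate hμ, fourier_band, map_smul, map_smul, fourier_band]
  refine Lp.ext ?_
  have h1 := ae_comp_mul μ (inv_ne_zero S.prime_ne_zero)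
    (indicatorConstLp_coeFn (p := 2) (hs := hE) (hμs := hfin) (c := (1 : ℂ)))
  filter_upwards [h1, S.coeFn_dilate (indicatorConstLp 2 hE hfin (1 : ℂ)),
    indicatorConstLp_coeFn (p := 2) (hs := hE') (hμs := hfin') (c := (1 : ℂ)),
    Lp.coeFn_smul (S.q * S.modulus μ : ℂ) (indicatorConstLp 2 hE' hfin' (1 : ℂ)),
    Lp.coeFn_smul ((Real.sqrt S.q : ℂ) * S.modulus μ)
      (S.dilate μ (indicatorConstLp 2 hE hfin (1 : ℂ)))] with x h2 h3 h4 h5 h6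
  rw [h5, h6, Pi.smul_apply, Pi.smul_apply, h3, h4, h2, smul_eq_mul, smul_eq_mul,
    ← S.sqrt_q_mul_self]
  change _ * E.indicator (fun _ => (1 : ℂ)) (S.prime⁻¹ * x) = _
  ring

lemma exists_preimage_subset_cell (j : ℕ) :
    ∃ l, (fun x => S.prime⁻¹ * x) ⁻¹' S.cell j ⊆ S.cell l := by
  obtain ⟨l, hl⟩ := S.exists_norm_sub_u_le (S.prime * S.u j)
  refine ⟨l, fun x hx => ?_⟩
  rw [Set.mem_preimage, mem_cell] at hx
  have h1 : ‖x - S.prime * S.u j‖ ≤ 1 := by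
    have h2 : x - S.prime * S.u j = S.prime * (S.prime⁻¹ * x - S.u j) := by
      rw [mul_sub, mul_inv_cancel_left₀ S.prime_ne_zero]
    rw [h2, norm_mul]
    exact mul_le_one₀ S.prime_lt_one.le (norm_nonneg _) hx
  rw [mem_cell]
  have h3 := norm_sub_le_of_le_of_le h1 (show ‖-(S.prime * S.u j - S.u l)‖ ≤ 1 by rwa [norm_neg])
  simpa using h3

/-- With m the modulus, D maps the `band` function of 𝔭E to √q m times that of E, commutes with the
projections, and scales squared norms by qm. Hence m ∫_E σ_{DV} = ∫_{𝔭E} σ_V, which is m times the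
integral of σ_V(𝔭·) over E. -/
lemma ae_spectral_map_dilate (hμ : μ (Metric.closedBall 0 1) = 1) {V : Submodule ℂ (Lp ℂ 2 μ)}
    (hV : IsTI μ S.lattice V) :
    ∀ᵐ ξ ∂μ, S.spectral (V.map (S.dilate μ)) ξ = S.spectral V (S.prime * ξ) := by
  have hDV := S.isTI_map_dilate hV
  have : CompleteSpace V := hV.1.completeSpace_coe
  have : CompleteSpace (V.map (S.dilate μ)) := hDV.1.completeSpace_coe
  have hm : AEMeasurable (fun x => S.spectral V (S.prime * x)) μ := by
    obtain ⟨c, hc, hmap⟩ := map_mul_left μ S.prime_ne_zero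
    refine AEMeasurable.comp_measurable (g := S.spectral V) ?_
      (continuous_const_mul S.prime).measurable
    rw [hmap]
    exact (S.aemeasurable_spectral hμ hV).smul_measure c
  have key := S.ae_eq_of_forall_setLIntegral_cell_eq
    (S.aemeasurable_spectral hμ hDV).ennreal_ofReal hm.ennreal_ofReal fun j E hE hj => ?_
  · filter_upwards [key] with ξ hξ
    exact (ENNReal.ofReal_eq_ofReal_iff (S.spectral_nonneg _ _) (S.spectral_nonneg _ _)).mp hξ
  obtain ⟨l, hl⟩ := S.exists_preimage_subset_cell j
  have hE' : MeasurableSet ((fun x => S.prime⁻¹ * x) ⁻¹' E) :=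
    (continuous_const_mul _).measurable hE
  have hj' : (fun x => S.prime⁻¹ * x) ⁻¹' E ⊆ S.cell l := (Set.preimage_mono hj).trans hl
  have hm0 : ENNReal.ofReal (S.modulus μ) ≠ 0 := by simpa using S.modulus_pos μ
  rw [← ENNReal.mul_right_inj hm0 ENNReal.ofReal_ne_top, S.setLIntegral_spectral hμ hDV hE hj,
    ← lintegral_indicator hE, ← S.lintegral_comp_prime_inv_mul]
  have h1 : ∫⁻ x, E.indicator (fun x => ENNReal.ofReal (S.spectral V (S.prime * x)))
      (S.prime⁻¹ * x) ∂μ =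
      ∫⁻ x in (fun x => S.prime⁻¹ * x) ⁻¹' E, ENNReal.ofReal (S.spectral V x) ∂μ := by
    rw [← lintegral_indicator hE']
    refine lintegral_congr fun x => ?_
    by_cases hx : S.prime⁻¹ * x ∈ E
    · rw [Set.indicator_of_mem hx, Set.indicator_of_mem (by exact hx),
        mul_inv_cancel_left₀ S.prime_ne_zero]
    · rw [Set.indicator_of_notMem hx, Set.indicator_of_notMem (by exact hx)]
  rw [h1, S.setLIntegral_spectral hμ hV hE' hj', enorm_sq_eq_ofReal, enorm_sq_eq_ofReal,
    ← ENNReal.ofReal_mul (S.modulus_pos μ).le]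
  congr 1
  have h2 := S.norm_dilate_sq (V.starProjection (S.band hμ hE'
    (S.measure_ne_top_of_subset_cell hj')))
  rw [← starProjection_map_dilate, S.dilate_band hμ hE (S.measure_ne_top_of_subset_cell hj),
    map_smul, norm_smul, mul_pow, norm_mul, mul_pow, Complex.norm_real, Complex.norm_real,
    Real.norm_of_nonneg (Real.sqrt_nonneg _), Real.norm_of_nonneg (S.modulus_pos μ).le,
    Real.sq_sqrt (Nat.cast_nonneg _)] at h2
  have hne : (S.q * S.modulus μ : ℝ) ≠ 0 :=
    (mul_pos (Nat.cast_pos.mpr S.q_pos) (S.modulus_pos μ)).ne'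
  refine mul_left_cancel₀ hne ?_
  rw [← h2]
  ring

end Dilation

/-! ### Existence and uniqueness of the spectral map -/

section SpectralMap

variable {K : Type*} [NontriviallyNormedField K] [IsUltrametricDist K] [ProperSpace K]
  [MeasurableSpace K] [BorelSpace K] {p : ℕ} [Fact p.Prime] [CharP K p]
  (S : LocalFieldSetting K p) {μ : Measure K} [μ.IsAddHaarMeasure]

lemma memLp_spectral (hμ : μ (Metric.closedBall 0 1) = 1) (V : S.TISpace μ) :
    MemLp (fun x => (S.spectral V.1 x : ℂ)) ∞ μ :=
  memLp_top_of_bound (Complex.measurable_ofReal.comp_aemeasurable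
    (S.aemeasurable_spectral hμ V.2)).aestronglyMeasurable 1 (ae_of_all _ fun x => by
      rw [Complex.norm_real, Real.norm_of_nonneg (S.spectral_nonneg _ x)]
      exact S.spectral_le_one _ x)

/-- The spectral function as an element of `L^∞(K)`. -/
noncomputable def spectralMap (hμ : μ (Metric.closedBall 0 1) = 1) (V : S.TISpace μ) : Lp ℂ ∞ μ :=
  (S.memLp_spectral hμ V).toLp _

lemma coeFn_spectralMap (hμ : μ (Metric.closedBall 0 1) = 1) (V : S.TISpace μ) :
    ∀ᵐ ξ ∂μ, S.spectralMap hμ V ξ = (S.spectral V.1 ξ : ℂ) := (S.memLp_spectral hμ V).coeFn_toLp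

lemma isSpectralMap_spectralMap (hμ : μ (Metric.closedBall 0 1) = 1) :
    S.IsSpectralMap μ (S.spectralMap hμ) where
  principal_eq φ W hW := by
    filter_upwards [S.coeFn_spectralMap hμ W, S.spectral_principal hμ φ] with ξ h1 h2
    rw [h1, hW, h2]
  additive V φ W _ hsum := by
    filter_upwards [S.coeFn_spectralMap hμ V, ae_all_iff.mpr fun n => S.coeFn_spectralMap hμ (W n),
      S.ae_hasSum_spectral hμ V.2 (fun n => (W n).2) hsum] with ξ h1 h2 h3
    simp_rw [h1, h2]
    exact Complex.hasSum_ofReal.mpr h3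

/-- Every V is an orthogonal sum of a sequence of principal spaces, on which the values are
prescribed. -/
lemma IsSpectralMap.unique {S : LocalFieldSetting K p} {s s' : S.TISpace μ → Lp ℂ ∞ μ}
    (hs : S.IsSpectralMap μ s) (hs' : S.IsSpectralMap μ s') : s = s' := by
  funext V
  obtain ⟨φ, hφ⟩ := S.exists_isOrthogonalSum_principal V.2
  let W : ℕ → S.TISpace μ := fun n => ⟨S.principal μ (φ n), S.isTI_principal (φ n)⟩
  refine Lp.ext ?_
  filter_upwards [hs.additive V φ W (fun _ => rfl) hφ, hs'.additive V φ W (fun _ => rfl) hφ,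
    ae_all_iff.mpr fun n => hs.principal_eq (φ n) (W n) rfl,
    ae_all_iff.mpr fun n => hs'.principal_eq (φ n) (W n) rfl] with ξ h1 h2 h3 h4
  simp_rw [h3] at h1
  simp_rw [h4] at h2
  exact h1.unique h2

lemma ae_hasSum_of_isOrthogonalSum_of_parsevalFrame (hμ : μ (Metric.closedBall 0 1) = 1)
    {V : Submodule ℂ (Lp ℂ 2 μ)} (hV : IsTI μ S.lattice V) {ι : Type*} [Countable ι]
    (φ : ι → Lp ℂ 2 μ) (hsum : IsOrthogonalSum V fun n => S.principal μ (φ n))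
    (hφ : ∀ n, IsParsevalFrame (S.principal μ (φ n)) fun k : ℕ => S.T μ k (φ n)) :
    ∀ᵐ ξ ∂μ, HasSum (fun n => ‖S.fourier μ (φ n) ξ‖ ^ 2) (S.spectral V ξ) := by
  have h : ∀ n, ∀ᵐ ξ ∂μ, S.spectral (S.principal μ (φ n)) ξ = ‖S.fourier μ (φ n) ξ‖ ^ 2 :=
    fun n => by
      -- The index type `Unit` makes this the case of one generator, which identifies each summand
      -- before additivity is applied.
      have hframe : IsParsevalFrame (S.principal μ (φ n))
          (fun i : ℕ × Unit => S.T μ i.1 ((fun _ => φ n) i.2)) :=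
        ⟨fun i => (hφ n).1 i.1, fun f hf =>
          (Equiv.prodPUnit ℕ).hasSum_iff.mpr ((hφ n).2 f hf)⟩
      filter_upwards [S.ae_hasSum_of_parsevalFrame hμ (S.isTI_principal _)
        (fun _ : Unit => φ n) hframe] with ξ hξ
      exact hξ.unique (hasSum_unique _)
  filter_upwards [ae_all_iff.mpr h, S.ae_hasSum_spectral hμ hV
    (fun n => S.isTI_principal (φ n)) hsum] with ξ h1 h2
  simpa only [h1] using h2

end SpectralMap

end LocalFieldSetting

theorem theorem3p2p6 {K : Type*} [NontriviallyNormedField K] [IsUltrametricDist K]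
    [ProperSpace K] [MeasurableSpace K] [BorelSpace K]
    (p : ℕ) [Fact p.Prime] [CharP K p]
    (μ : Measure K) [μ.IsAddHaarMeasure] (hμ : μ (Metric.closedBall 0 1) = 1)
    (S : LocalFieldSetting K p) :
    -- (A)
    (∀ V : S.TISpace μ,
      (∀ (ι : Type) [Countable ι] (φ : ι → Lp ℂ 2 μ),
        LocalFieldSetting.IsParsevalFrame V.1 (fun i : ℕ × ι => S.T μ i.1 (φ i.2)) →
        ∀ᵐ ξ ∂μ, HasSum (fun n => ‖S.fourier μ (φ n) ξ‖ ^ 2) (S.spectral V.1 ξ)) ∧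
      (∀ (ι κ : Type) [Countable ι] [Countable κ] (φ : ι → Lp ℂ 2 μ) (ψ : κ → Lp ℂ 2 μ),
        LocalFieldSetting.IsParsevalFrame V.1 (fun i : ℕ × ι => S.T μ i.1 (φ i.2)) →
        LocalFieldSetting.IsParsevalFrame V.1 (fun i : ℕ × κ => S.T μ i.1 (ψ i.2)) →
        ∀ᵐ ξ ∂μ, ∑' n, ‖S.fourier μ (φ n) ξ‖ ^ 2 = ∑' n, ‖S.fourier μ (ψ n) ξ‖ ^ 2)) ∧
    -- (B)
    ((∀ φ : Lp ℂ 2 μ, LocalFieldSetting.IsTI μ S.lattice (S.principal μ φ)) ∧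
      (∃ s : S.TISpace μ → Lp ℂ ∞ μ,
        (∀ V : S.TISpace μ, ∀ᵐ ξ ∂μ, s V ξ = (S.spectral V.1 ξ : ℂ)) ∧
        S.IsSpectralMap μ s ∧
        ∀ s' : S.TISpace μ → Lp ℂ ∞ μ, S.IsSpectralMap μ s' → s' = s) ∧
      (∀ (ι : Type) [Countable ι] (V : S.TISpace μ) (W : ι → S.TISpace μ),
        LocalFieldSetting.IsOrthogonalSum V.1 (fun n => (W n).1) →
        ∀ᵐ ξ ∂μ, HasSum (fun n => S.spectral (W n).1 ξ) (S.spectral V.1 ξ))) ∧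
    -- (C)
    (∀ (V : S.TISpace μ) (ι : Type) [Countable ι] (φ : ι → Lp ℂ 2 μ),
      LocalFieldSetting.IsOrthogonalSum V.1 (fun n => S.principal μ (φ n)) →
      (∀ n, LocalFieldSetting.IsParsevalFrame (S.principal μ (φ n))
        (fun k : ℕ => S.T μ k (φ n))) →
      ∀ᵐ ξ ∂μ, HasSum (fun n => ‖S.fourier μ (φ n) ξ‖ ^ 2) (S.spectral V.1 ξ)) ∧
    -- (D)
    (∀ V : S.TISpace μ,
      LocalFieldSetting.IsTI μ S.dilatedLattice (V.1.map (S.dilate μ)) ∧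
      LocalFieldSetting.IsTI μ S.lattice (V.1.map (S.dilate μ)) ∧
      ∀ᵐ ξ ∂μ, S.spectral (V.1.map (S.dilate μ)) ξ = S.spectral V.1 (S.prime * ξ)) ∧
    -- (E)
    (∀ V : S.TISpace μ, ∀ᵐ ξ ∂μ,
      ((S.multiplicity V.1 ξ : ℕ∞) : ℝ≥0∞) =
        ∑' k : ℕ, ENNReal.ofReal (S.spectral V.1 (ξ + S.u k))) := by
  refine ⟨fun V => ⟨fun ι _ φ hφ => S.ae_hasSum_of_parsevalFrame hμ V.2 φ hφ,
      fun ι κ _ _ φ ψ hφ hψ => ?_⟩,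
    ⟨S.isTI_principal, ⟨S.spectralMap hμ, S.coeFn_spectralMap hμ, S.isSpectralMap_spectralMap hμ,
      fun s' hs' => hs'.unique (S.isSpectralMap_spectralMap hμ)⟩,
      fun ι _ V W hsum => S.ae_hasSum_spectral hμ V.2 (fun n => (W n).2) hsum⟩,
    fun V ι _ φ hsum hφ => S.ae_hasSum_of_isOrthogonalSum_of_parsevalFrame hμ V.2 φ hsum hφ,
    fun V => ⟨S.isTI_dilatedLattice_map_dilate V.2, S.isTI_map_dilate V.2,
      S.ae_spectral_map_dilate hμ V.2⟩,
    fun V => ae_of_all _ fun ξ => S.multiplicity_eq_tsum V.1 ξ⟩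
  filter_upwards [S.ae_hasSum_of_parsevalFrame hμ V.2 φ hφ,
    S.ae_hasSum_of_parsevalFrame hμ V.2 ψ hψ] with ξ h1 h2
  rw [h1.tsum_eq, h2.tsum_eq]
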